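/- **Theorem 2.3.** Let $B$ be a simplicial $3$-ball, i.e. a finite simplicial complex whose geometric realization is homeomorphic to the closed $3$-ball, and let $\partial B$ be its boundary complex (generated by the $2$-faces contained in exactly one $3$-face). Suppose that $B$ is reduced: each $2$-face of $B$ not in $\partial B$ has at most one edge contained in $\partial B$. A spanning edge of $B$ is an edge of $B$ that is not contained in $\partial B$ but whose two end vertices are in $\partial B$. A maximal interior graph component of $B$ is a connected component (possibly a single vertex) of the graph consisting of all vertices of $B$ not in $\partial B$ and all edges of $B$ joining two such vertices. For such a component $I$, let $\mathrm{Star}_B I$ be its closed star neighbourhood, i.e. the subcomplex of all faces of simplices of $B$ that meet $I$. A spanning edge is strict if there is no maximal interior graph component $I$ of $B$ such that both end vertices of the edge lie in one and the same connected component of $\partial B\cap \mathrm{Star}_B I$. If $B$ has at least one spanning edge and every spanning edge of $B$ is strict, then $B$ is not constructible. Here constructibility is defined recursively: a pure $d$-dimensional simplicial complex $C$ is constructible if $C$ is a simplex (for $d=-1$, the complex $\{\emptyset\}$), or if there are $d$-dimensional constructible subcomplexes $C_1, C_2$ with $C=C_1\cup C_2$ such that $C_1\cap C_2$ is a $(d-1)$-dimensional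 constructible complex. -/

import Mathlib

/-! Simplicial complexes are Mathlib's `PreAbstractSimplicialComplex V`: downward closed families of
nonempty finite subsets of `V` (not every element of `V` need be a vertex). The empty face is left
out, so the complex `⊥` plays the role of the `(-1)`-dimensional complex `{∅}`. A `k`-face has
`k + 1` elements; `⊔` and `⊓` are union and intersection of complexes. -/

namespace SimplicialBall

variable {V : Type*}

/-- The full simplex on a finite vertex set `s`, with all its faces. -/
def simplex (s : Finset V) : PreAbstractSimplicialComplex V where
  faces := {t | t.Nonempty ∧ t ⊆ s}
  isRelLowerSet_faces := fun _ ht => ⟨ht.1, fun _ hu hne => ⟨hne, hu.trans ht.2⟩⟩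

/-- `ConstructibleAux n K`: the complex `K` is constructible of dimension `n - 1`, so that all its
facets have `n` vertices. Purity is automatic. The case `n = 0` is the empty simplex `{∅}`, so that
every nonempty finite set of points is a constructible `0`-dimensional complex, as usual. -/
inductive ConstructibleAux : ℕ → PreAbstractSimplicialComplex V → Prop
  | simplex (s : Finset V) : ConstructibleAux s.card (simplex s)
  | union {n : ℕ} {K₁ K₂ : PreAbstractSimplicialComplex V}
      (h₁ : ConstructibleAux (n + 1) K₁) (h₂ : ConstructibleAux (n + 1) K₂)
      (h : ConstructibleAux n (K₁ ⊓ K₂)) : ConstructibleAux (n + 1) (K₁ ⊔ K₂)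

/-- `K` is a constructible `d`-dimensional simplicial complex. -/
def IsConstructible (d : ℕ) (K : PreAbstractSimplicialComplex V) : Prop :=
  ConstructibleAux (d + 1) K

/-- The geometric realization of `K`, in barycentric coordinates, as a subspace of `V → ℝ`.
(For finite `K`, which is the only case used, this is the usual topology.) -/
def realization (K : PreAbstractSimplicialComplex V) : Set (V → ℝ) :=
  {x | ∃ s ∈ K, (∀ v, 0 ≤ x v) ∧ (∀ v, v ∉ s → x v = 0) ∧ ∑ v ∈ s, x v = 1}

/-- A simplicial `d`-ball: a finite simplicial complex whose geometric realization is homeomorphic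
to the closed unit ball of Euclidean `d`-space. -/
def IsSimplicialBall (d : ℕ) (K : PreAbstractSimplicialComplex V) : Prop :=
  K.faces.Finite ∧
    Nonempty (realization K ≃ₜ Metric.closedBall (0 : EuclideanSpace ℝ (Fin d)) 1)

/-- The vertices of `K`. -/
def vertexSet (K : PreAbstractSimplicialComplex V) : Set V := {v | {v} ∈ K}

/-- The boundary complex `∂B` of a simplicial `3`-ball: the subcomplex generated by the `2`-faces
that lie in exactly one `3`-face. -/
def boundary (B : PreAbstractSimplicialComplex V) : PreAbstractSimplicialComplex V where
  faces := {s | s.Nonempty ∧ ∃ t ∈ B, t.card = 3 ∧ s ⊆ t ∧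
    ∃! u : Finset V, u ∈ B ∧ u.card = 4 ∧ t ⊆ u}
  isRelLowerSet_faces := by
    rintro s ⟨hs, t, htB, htc, hst, hu⟩
    exact ⟨hs, fun r hr hne => ⟨hne, t, htB, htc, Finset.Subset.trans hr hst, hu⟩⟩

/-- Each `2`-face of `B` that is not in `∂B` has at most one edge in `∂B`. -/
def IsReduced (B : PreAbstractSimplicialComplex V) : Prop :=
  ∀ t ∈ B, t.card = 3 → t ∉ boundary B →
    {e : Finset V | e ⊆ t ∧ e.card = 2 ∧ e ∈ boundary B}.Subsingleton

/-- A spanning edge: an edge of `B` not in `∂B` whose two end vertices are in `∂B`. -/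
def IsSpanningEdge (B : PreAbstractSimplicialComplex V) (e : Finset V) : Prop :=
  e ∈ B ∧ e.card = 2 ∧ e ∉ boundary B ∧ ∀ v ∈ e, v ∈ vertexSet (boundary B)

/-- The graph with vertex set `S` whose edges are the edges of `K` with both ends in `S`. -/
def edgeGraph (K : PreAbstractSimplicialComplex V) (S : Set V) : SimpleGraph S where
  Adj u v := u ≠ v ∧ ∃ s ∈ K, (u : V) ∈ s ∧ (v : V) ∈ s
  symm := ⟨fun _ _ ⟨hne, s, hs, hu, hv⟩ => ⟨hne.symm, s, hs, hv, hu⟩⟩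
  loopless := ⟨fun _ h => h.1 rfl⟩

/-- The interior vertices of `B`: the vertices not in `∂B`. -/
def interiorVertices (B : PreAbstractSimplicialComplex V) : Set V :=
  vertexSet B \ vertexSet (boundary B)

/-- The maximal interior graph components of `B`: the connected components (isolated vertices
included) of the graph of all interior vertices and all edges between interior vertices. -/
abbrev MaxInteriorComponent (B : PreAbstractSimplicialComplex V) : Type _ :=
  (edgeGraph B (interiorVertices B)).ConnectedComponent

/-- The connected components of a complex `L`, given by those of its `1`-skeleton. -/
abbrev Component (L : PreAbstractSimplicialComplex V) : Type _ :=
  (edgeGraph L (vertexSet L)).ConnectedComponent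

/-- The closed star neighbourhood in `B` of a subcomplex with vertex set `S`: all faces of the
simplices of `B` that meet the subcomplex, i.e. that have a vertex in `S`. -/
def closedStar (B : PreAbstractSimplicialComplex V) (S : Set V) :
    PreAbstractSimplicialComplex V where
  faces := {s | s.Nonempty ∧ ∃ t ∈ B, s ⊆ t ∧ ∃ v ∈ t, v ∈ S}
  isRelLowerSet_faces := by
    rintro s ⟨hs, t, htB, hst, hv⟩
    exact ⟨hs, fun r hr hne => ⟨hne, t, htB, Finset.Subset.trans hr hst, hv⟩⟩

/-- The spanning edge `e` is strict: there is no maximal interior graph component `I` such that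
both end vertices of `e` lie in one and the same connected component of `∂B ∩ Star_B I`. -/
def IsStrict (B : PreAbstractSimplicialComplex V) (e : Finset V) : Prop :=
  ¬ ∃ (I : MaxInteriorComponent B)
      (C : Component (boundary B ⊓ closedStar B (Subtype.val '' I.supp))),
    ∀ v ∈ e, v ∈ Subtype.val '' C.supp

end SimplicialBall

/-! Suppose `B` is constructible and follow its recursive decomposition downwards. The claim is that
no piece contains a spanning edge; since `B` is a piece of itself, this is absurd. In a single
tetrahedron every edge is on the boundary, so it suffices that no dividing surface `D = C₁ ⊓ C₂`
ever contains a spanning edge (`IsSplit.not_spanning_inter`): then spanning edges never reach the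
boundary of a piece.

If `D` contains spanning edges, they are chords of `D`. An innermost one, `e`, cuts off triangles
`T` carrying no other spanning edge. By reducedness the triangle of `T` at `e` has an interior
vertex, in a component `I`. Let `TI` be the triangles of `T` meeting `I`. An edge interior to `D`,
other than `e`, on a triangle of `T` has an interior vertex of `B`, so its two triangles both meet
`I` or both miss it. Hence the mod 2 boundary of `TI` is `e` together with edges of the boundary of
`D`, which joins the ends of `e` inside the boundary of the current piece and the star of `I`. If
that route lay in `∂B`, strictness would fail at once.

It may however cross interior vertices of `B` exposed by earlier cuts. The labels in `IsPiece` deal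
with this: each exposed vertex is labelled by a vertex standing for a component of `∂B ∩ Star_B I`,
and labels along the route stay related. New labels exist because, once `D` has no spanning edge,
all its triangles meet one component (`IsSplit.exists_component`) and its boundary is connected.

No classification of surfaces is used. Constructible complexes are strongly connected with vanishing
reduced `𝔽₂`-homology below the top dimension, and this replaces disc topology, provided each ridge
lies in at most two facets. For a ball that last fact needs topology: three tetrahedra on one
triangle would contradict invariance of domain, proved here from a Milnor–Rogers style no-retraction
theorem. -/

namespace SimplicialBall

/-! ### Augmented simplicial chains modulo 2 -/

section Chains

variable {V : Type*}

/-- The faces of `K`, the empty face included. -/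
def Face (K : PreAbstractSimplicialComplex V) (s : Finset V) : Prop := s ∈ K ∨ s = ∅

theorem face_empty (K : PreAbstractSimplicialComplex V) : Face K ∅ := Or.inr rfl

theorem Face.mem {K : PreAbstractSimplicialComplex V} {s : Finset V} (h : Face K s)
    (hs : s.Nonempty) : s ∈ K := h.resolve_right hs.ne_empty

theorem Face.mem_of_card {K : PreAbstractSimplicialComplex V} {s : Finset V} {n : ℕ}
    (h : Face K s) (hs : s.card = n + 1) : s ∈ K :=
  h.mem (Finset.card_pos.1 (by omega))

theorem nonempty_of_mem {K : PreAbstractSimplicialComplex V} {s : Finset V} (h : s ∈ K) :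
    s.Nonempty := (K.isRelLowerSet_faces h).1

theorem mem_of_subset {K : PreAbstractSimplicialComplex V} {s t : Finset V} (h : s ∈ K)
    (hts : t ⊆ s) (ht : t.Nonempty) : t ∈ K := (K.isRelLowerSet_faces h).2 hts ht

theorem Face.subset {K : PreAbstractSimplicialComplex V} {s t : Finset V} (h : Face K s)
    (hts : t ⊆ s) : Face K t := by
  rcases t.eq_empty_or_nonempty with rfl | ht
  · exact face_empty K
  · exact Or.inl (mem_of_subset (h.mem (ht.mono hts)) hts ht)

theorem face_inf {K L : PreAbstractSimplicialComplex V} {s : Finset V} :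
    Face (K ⊓ L) s ↔ Face K s ∧ Face L s := by
  have : s ∈ K ⊓ L ↔ s ∈ K ∧ s ∈ L := Iff.rfl
  simp only [Face, this]; tauto

theorem face_sup {K L : PreAbstractSimplicialComplex V} {s : Finset V} :
    Face (K ⊔ L) s ↔ Face K s ∨ Face L s := by
  have : s ∈ K ⊔ L ↔ s ∈ K ∨ s ∈ L := Iff.rfl
  simp only [Face, this]; tauto

theorem face_simplex {s t : Finset V} : Face (simplex s) t ↔ t ⊆ s := by
  have : t ∈ simplex s ↔ t.Nonempty ∧ t ⊆ s := Iff.rfl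
  simp only [Face, this]
  rcases t.eq_empty_or_nonempty with rfl | ht
  · simp
  · simp [ht, ht.ne_empty]

/-- The augmented chains of `K` with coefficients in `𝔽₂`, spanned by the faces with `k`
elements. -/
def chains (K : PreAbstractSimplicialComplex V) (k : ℕ) :
    Submodule (ZMod 2) (Finset V →₀ ZMod 2) :=
  Finsupp.supported (ZMod 2) (ZMod 2) {s | Face K s ∧ s.card = k}

theorem mem_chains {K : PreAbstractSimplicialComplex V} {k : ℕ} {z : Finset V →₀ ZMod 2} :
    z ∈ chains K k ↔ ∀ s, z s ≠ 0 → Face K s ∧ s.card = k := by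
  simp only [chains, Finsupp.mem_supported, Set.subset_def, Finset.mem_coe,
    Finsupp.mem_support_iff, Set.mem_ofPred_eq]

theorem single_mem_chains {K : PreAbstractSimplicialComplex V} {s : Finset V} {k : ℕ}
    (h : Face K s) (hs : s.card = k) : Finsupp.single s (1 : ZMod 2) ∈ chains K k :=
  Finsupp.single_mem_supported _ _ ⟨h, hs⟩

theorem chains_inf (K L : PreAbstractSimplicialComplex V) (k : ℕ) :
    chains (K ⊓ L) k = chains K k ⊓ chains L k := by
  rw [chains, chains, chains, ← Finsupp.supported_inter]
  congr 1
  ext s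
  simp only [Set.mem_ofPred_eq, Set.mem_inter_iff, face_inf]
  tauto

theorem chains_sup (K L : PreAbstractSimplicialComplex V) (k : ℕ) :
    chains (K ⊔ L) k = chains K k ⊔ chains L k := by
  rw [chains, chains, chains, ← Finsupp.supported_union]
  congr 1
  ext s
  simp only [Set.mem_ofPred_eq, Set.mem_union, face_sup]
  tauto

theorem zmod_two_cases (a : ZMod 2) : a = 0 ∨ a = 1 := by
  revert a; decide

theorem zmod_two_eq_one {a : ZMod 2} (h : a ≠ 0) : a = 1 := (zmod_two_cases a).resolve_left h

theorem linearMap_eq_zero_of_single {M : Type*} [AddCommGroup M] [Module (ZMod 2) M]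
    (f : (Finset V →₀ ZMod 2) →ₗ[ZMod 2] M) (h : ∀ s, f (Finsupp.single s 1) = 0) : f = 0 := by
  ext s; simpa using h s

variable [DecidableEq V]

/-- The boundary operator of the augmented chain complex. -/
noncomputable def bd : (Finset V →₀ ZMod 2) →ₗ[ZMod 2] (Finset V →₀ ZMod 2) :=
  Finsupp.linearCombination (ZMod 2) fun s => ∑ v ∈ s, Finsupp.single (s.erase v) 1

theorem bd_single (s : Finset V) :
    bd (Finsupp.single s (1 : ZMod 2)) = ∑ v ∈ s, Finsupp.single (s.erase v) 1 := by
  simp [bd]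

theorem bd_bd (z : Finset V →₀ ZMod 2) : bd (bd z) = 0 := by
  suffices h : (bd (V := V)) ∘ₗ bd = 0 from LinearMap.congr_fun h z
  refine linearMap_eq_zero_of_single _ fun s => ?_
  simp only [LinearMap.comp_apply, bd_single, map_sum]
  rw [Finset.sum_sigma']
  refine Finset.sum_involution (fun a _ => ⟨a.2, a.1⟩) ?_ ?_ ?_ ?_
  · rintro ⟨v, w⟩ -
    simp only [Finset.erase_right_comm (a := w)]
    exact ZModModule.add_self _
  · rintro ⟨v, w⟩ hvw - h
    simp only [Finset.mem_sigma, Finset.mem_erase] at hvw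
    simp only [Sigma.mk.injEq] at h
    exact hvw.2.1 h.1
  · rintro ⟨v, w⟩ hvw
    simp only [Finset.mem_sigma, Finset.mem_erase] at hvw ⊢
    exact ⟨hvw.2.2, fun h => hvw.2.1 h.symm, hvw.1⟩
  · rintro ⟨v, w⟩ -
    rfl

theorem bd_single_apply (s u : Finset V) :
    bd (Finsupp.single s (1 : ZMod 2)) u = if u ⊆ s ∧ s.card = u.card + 1 then 1 else 0 := by
  rw [bd_single, Finsupp.finsetSum_apply]
  split_ifs with h
  · obtain ⟨v, hvu, rfl⟩ : ∃ v, v ∉ u ∧ insert v u = s := by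
      have := (Finset.covBy_iff_card_sdiff_eq_one.2 ⟨h.1, by
        rw [Finset.card_sdiff_of_subset h.1]; omega⟩)
      exact Finset.covBy_iff_exists_insert.1 this
    rw [Finset.sum_eq_single v]
    · simp [hvu]
    · intro w hw hwv
      rw [Finsupp.single_eq_of_ne]
      intro h'
      have : v ∈ (insert v u).erase w := by simp [Ne.symm hwv]
      rw [← h'] at this
      exact hvu this
    · simp
  · refine Finset.sum_eq_zero fun v hv => ?_
    rw [Finsupp.single_eq_of_ne]
    rintro rfl
    exact h ⟨Finset.erase_subset _ _, by rw [Finset.card_erase_add_one hv]⟩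

theorem bd_apply (z : Finset V →₀ ZMod 2) (u : Finset V) :
    bd z u = ∑ s ∈ z.support, if u ⊆ s ∧ s.card = u.card + 1 then z s else 0 := by
  have h : bd z = ∑ s ∈ z.support, z s • bd (Finsupp.single s 1) := by
    simp only [bd_single]
    rfl
  rw [h, Finsupp.finsetSum_apply]
  refine Finset.sum_congr rfl fun s _ => ?_
  rw [Finsupp.smul_apply, bd_single_apply]
  split_ifs <;> simp

theorem bd_mem_chains {K : PreAbstractSimplicialComplex V} {k : ℕ} {z : Finset V →₀ ZMod 2}
    (hz : z ∈ chains K (k + 1)) : bd z ∈ chains K k := by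
  rw [mem_chains] at hz ⊢
  intro u hu
  rw [bd_apply] at hu
  obtain ⟨s, hs, hsu⟩ := Finset.exists_ne_zero_of_sum_ne_zero hu
  have h : u ⊆ s ∧ s.card = u.card + 1 := by
    by_contra h
    exact hsu (if_neg h)
  have := hz s (Finsupp.mem_support_iff.1 hs)
  exact ⟨this.1.subset h.1, by omega⟩

/-- The cone operator with apex `v`. -/
noncomputable def cone (v : V) : (Finset V →₀ ZMod 2) →ₗ[ZMod 2] (Finset V →₀ ZMod 2) :=
  Finsupp.linearCombination (ZMod 2) fun s => if v ∈ s then 0 else Finsupp.single (insert v s) 1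

theorem cone_single (v : V) (s : Finset V) : cone v (Finsupp.single s (1 : ZMod 2)) =
    if v ∈ s then 0 else Finsupp.single (insert v s) 1 := by
  simp [cone]

/-- Coning is a contracting homotopy, also on the empty face because the complex is augmented. If `v
∈ s`, only the face opposite `v` survives coning; otherwise the faces of the cone through `v` cancel
against the cone of the boundary. -/
theorem bd_cone_add_cone_bd (v : V) (z : Finset V →₀ ZMod 2) :
    bd (cone v z) + cone v (bd z) = z := by
  suffices h : bd ∘ₗ cone v + cone v ∘ₗ bd - LinearMap.id = 0 by
    have := LinearMap.congr_fun h z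
    simpa [sub_eq_zero] using this
  refine linearMap_eq_zero_of_single _ fun s => ?_
  simp only [LinearMap.sub_apply, LinearMap.add_apply, LinearMap.comp_apply, LinearMap.id_apply,
    cone_single, sub_eq_zero]
  split_ifs with hv
  · rw [map_zero, zero_add, bd_single, map_sum, Finset.sum_eq_single v]
    · rw [cone_single, if_neg (Finset.notMem_erase _ _), Finset.insert_erase hv]
    · intro w hw hwv
      rw [cone_single, if_pos (Finset.mem_erase.2 ⟨hwv.symm, hv⟩)]
    · exact fun h => absurd hv h
  · rw [bd_single, bd_single, Finset.sum_insert hv, Finset.erase_insert hv, map_sum, add_assoc,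
      ← Finset.sum_add_distrib, Finset.sum_eq_zero, add_zero]
    intro w hw
    have hwv : v ≠ w := fun h => hv (h ▸ hw)
    rw [cone_single, if_neg (fun h => hv (Finset.mem_of_mem_erase h)),
      Finset.erase_insert_of_ne hwv]
    exact ZModModule.add_self _

theorem cone_mem_chains {s : Finset V} {v : V} (hv : v ∈ s) {k : ℕ} {z : Finset V →₀ ZMod 2}
    (hz : z ∈ chains (simplex s) k) : cone v z ∈ chains (simplex s) (k + 1) := by
  have h : cone v z = ∑ t ∈ z.support, z t • cone v (Finsupp.single t 1) := by
    simp only [cone_single]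
    rfl
  rw [h]
  refine Submodule.sum_mem _ fun t ht => Submodule.smul_mem _ _ ?_
  obtain ⟨h1, h2⟩ := mem_chains.1 hz t (Finsupp.mem_support_iff.1 ht)
  rw [cone_single]
  split_ifs with hvt
  · exact Submodule.zero_mem _
  · refine single_mem_chains (face_simplex.2 ?_) (by rw [Finset.card_insert_of_notMem hvt, h2])
    exact Finset.insert_subset hv (face_simplex.1 h1)

end Chains

/-! ### Strong connectedness and acyclicity of constructible complexes -/

section Constructible

variable {V : Type*}

theorem ConstructibleAux.finite {n : ℕ} {K : PreAbstractSimplicialComplex V}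
    (h : ConstructibleAux n K) : {s | Face K s}.Finite := by
  induction h with
  | simplex s =>
    refine (s.powerset.finite_toSet).subset fun t ht => ?_
    simpa using face_simplex.1 ht
  | union _ _ _ ih₁ ih₂ _ =>
    refine (ih₁.union ih₂).subset fun s hs => ?_
    exact face_sup.1 hs

theorem ConstructibleAux.exists_facet {n : ℕ} {K : PreAbstractSimplicialComplex V}
    (h : ConstructibleAux n K) {s : Finset V} (hs : Face K s) :
    ∃ t, Face K t ∧ t.card = n ∧ s ⊆ t := by
  induction h with
  | simplex t => exact ⟨t, face_simplex.2 subset_rfl, rfl, face_simplex.1 hs⟩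
  | union _ _ _ ih₁ ih₂ _ =>
    rcases face_sup.1 hs with h | h
    · obtain ⟨t, h1, h2⟩ := ih₁ h
      exact ⟨t, face_sup.2 (Or.inl h1), h2⟩
    · obtain ⟨t, h1, h2⟩ := ih₂ h
      exact ⟨t, face_sup.2 (Or.inr h1), h2⟩

theorem ConstructibleAux.card_le {n : ℕ} {K : PreAbstractSimplicialComplex V}
    (h : ConstructibleAux n K) {s : Finset V} (hs : Face K s) : s.card ≤ n := by
  obtain ⟨t, -, rfl, hst⟩ := h.exists_facet hs
  exact Finset.card_le_card hst

/-- Constructible complexes are strongly connected. -/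
theorem ConstructibleAux.mem_of_adjacent {n : ℕ} {K : PreAbstractSimplicialComplex V}
    (h : ConstructibleAux n K) (T : Set (Finset V))
    (hT : ∀ s t u, Face K s → Face K t → s.card = n → t.card = n → u.card + 1 = n → u ⊆ s → u ⊆ t →
      s ∈ T → t ∈ T) {s t : Finset V} (hs : Face K s) (hsn : s.card = n) (hsT : s ∈ T)
    (ht : Face K t) (htn : t.card = n) : t ∈ T := by
  induction h generalizing s t with
  | simplex r =>
    rwa [Finset.eq_of_subset_of_card_le (face_simplex.1 ht) htn.ge,
      ← Finset.eq_of_subset_of_card_le (face_simplex.1 hs) hsn.ge]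
  | @union n K₁ K₂ h₁ h₂ h ih₁ ih₂ _ =>
    have a₁ : ∀ s t, Face K₁ s → Face K₁ t → s.card = n + 1 → t.card = n + 1 → s ∈ T → t ∈ T :=
      fun s t hs ht hsn htn hsT => ih₁ (fun s t u hs ht => hT s t u (face_sup.2 (Or.inl hs))
        (face_sup.2 (Or.inl ht))) hs hsn hsT ht htn
    have a₂ : ∀ s t, Face K₂ s → Face K₂ t → s.card = n + 1 → t.card = n + 1 → s ∈ T → t ∈ T :=
      fun s t hs ht hsn htn hsT => ih₂ (fun s t u hs ht => hT s t u (face_sup.2 (Or.inr hs))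
        (face_sup.2 (Or.inr ht))) hs hsn hsT ht htn
    -- A facet of the intersection is a ridge lying in a facet of either piece, which bridges the
    -- two.
    obtain ⟨u, hu, hun, -⟩ := h.exists_facet (face_empty _)
    obtain ⟨s₁, hs₁, hsn₁, hus₁⟩ := h₁.exists_facet (face_inf.1 hu).1
    obtain ⟨s₂, hs₂, hsn₂, hus₂⟩ := h₂.exists_facet (face_inf.1 hu).2
    have hu1 : u.card + 1 = n + 1 := by omega
    have e₁ := hT s₁ s₂ u (face_sup.2 (Or.inl hs₁)) (face_sup.2 (Or.inr hs₂)) hsn₁ hsn₂ hu1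
      hus₁ hus₂
    have e₂ := hT s₂ s₁ u (face_sup.2 (Or.inr hs₂)) (face_sup.2 (Or.inl hs₁)) hsn₂ hsn₁ hu1
      hus₂ hus₁
    rcases face_sup.1 hs with hs | hs <;> rcases face_sup.1 ht with ht | ht
    · exact a₁ s t hs ht hsn htn hsT
    · exact a₂ s₂ t hs₂ ht hsn₂ htn (e₁ (a₁ s s₁ hs hs₁ hsn hsn₁ hsT))
    · exact a₁ s₁ t hs₁ ht hsn₁ htn (e₂ (a₂ s s₂ hs hs₂ hsn hsn₂ hsT))
    · exact a₂ s t hs ht hsn htn hsT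

variable [DecidableEq V]

/-- The reduced homology of a constructible complex vanishes below its dimension. -/
theorem ConstructibleAux.exists_bd_eq {n : ℕ} {K : PreAbstractSimplicialComplex V}
    (h : ConstructibleAux n K) {k : ℕ} (hk : k < n) {z : Finset V →₀ ZMod 2} (hz : z ∈ chains K k)
    (hz0 : bd z = 0) : ∃ w ∈ chains K (k + 1), bd w = z := by
  induction h generalizing k z with
  | simplex s =>
    obtain ⟨v, hv⟩ : s.Nonempty := Finset.card_pos.1 (by omega)
    refine ⟨cone v z, cone_mem_chains hv hz, ?_⟩
    simpa [hz0] using bd_cone_add_cone_bd v z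
  | @union n K₁ K₂ h₁ h₂ h ih₁ ih₂ ih =>
    have le₁ : ∀ k, chains K₁ k ≤ chains (K₁ ⊔ K₂) k := fun k => by
      rw [chains_sup]; exact le_sup_left
    have le₂ : ∀ k, chains K₂ k ≤ chains (K₁ ⊔ K₂) k := fun k => by
      rw [chains_sup]; exact le_sup_right
    cases k with
    | zero =>
      have : z ∈ chains K₁ 0 := by
        rw [mem_chains] at hz ⊢
        intro s hs
        have := (hz s hs).2
        exact ⟨Or.inr (Finset.card_eq_zero.1 this), this⟩
      obtain ⟨w, hw, hwz⟩ := ih₁ hk this hz0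
      exact ⟨w, le₁ _ hw, hwz⟩
    | succ k =>
      -- Mayer–Vietoris by hand: split the cycle, fill the common boundary of its parts inside the
      -- intersection, and use that filling to close up each part.
      rw [chains_sup] at hz
      obtain ⟨z₁, hz₁, z₂, hz₂, rfl⟩ := Submodule.mem_sup.1 hz
      have hb : bd z₁ = bd z₂ := by
        rw [map_add] at hz0
        rw [eq_neg_of_add_eq_zero_left hz0, ZModModule.neg_eq_self]
      have hm : bd z₁ ∈ chains (K₁ ⊓ K₂) k := by
        rw [chains_inf]
        exact ⟨bd_mem_chains hz₁, hb ▸ bd_mem_chains hz₂⟩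
      obtain ⟨m, hm, hmz⟩ := ih (by omega) hm (bd_bd _)
      rw [chains_inf] at hm
      obtain ⟨w₁, hw₁, hwz₁⟩ := ih₁ hk (Submodule.add_mem _ hz₁ hm.1)
        (by rw [map_add, hmz, ZModModule.add_self])
      obtain ⟨w₂, hw₂, hwz₂⟩ := ih₂ hk (Submodule.add_mem _ hz₂ hm.2)
        (by rw [map_add, hmz, hb, ZModModule.add_self])
      refine ⟨w₁ + w₂, Submodule.add_mem _ (le₁ _ hw₁) (le₂ _ hw₂), ?_⟩
      rw [map_add, hwz₁, hwz₂, add_add_add_comm, ZModModule.add_self, add_zero]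

end Constructible

/-! ### Pseudomanifolds, boundary faces and the fundamental chain -/

section Pseudomanifold

variable {V : Type*}

/-- Every face with `n - 1` elements is contained in at most two faces with `n` elements. -/
def IsPseudomanifold (n : ℕ) (K : PreAbstractSimplicialComplex V) : Prop :=
  ∀ u s₁ s₂ s₃ : Finset V, u.card + 1 = n → (Face K s₁ ∧ s₁.card = n) → (Face K s₂ ∧ s₂.card = n) →
    (Face K s₃ ∧ s₃.card = n) → u ⊆ s₁ → u ⊆ s₂ → u ⊆ s₃ → s₁ = s₂ ∨ s₁ = s₃ ∨ s₂ = s₃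

/-- A face with `n - 1` elements that is contained in exactly one face with `n` elements. -/
def BdryFace (n : ℕ) (K : PreAbstractSimplicialComplex V) (u : Finset V) : Prop :=
  u.card + 1 = n ∧ ∃! s, (Face K s ∧ s.card = n) ∧ u ⊆ s

theorem BdryFace.face {n : ℕ} {K : PreAbstractSimplicialComplex V} {u : Finset V}
    (h : BdryFace n K u) : Face K u := by
  obtain ⟨-, s, ⟨⟨hs, -⟩, hus⟩, -⟩ := h
  exact hs.subset hus

theorem IsPseudomanifold.mono {n : ℕ} {K L : PreAbstractSimplicialComplex V}
    (h : IsPseudomanifold n L) (hKL : ∀ s, Face K s → Face L s) : IsPseudomanifold n K :=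
  fun u s₁ s₂ s₃ hu h₁ h₂ h₃ => h u s₁ s₂ s₃ hu ⟨hKL _ h₁.1, h₁.2⟩ ⟨hKL _ h₂.1, h₂.2⟩
    ⟨hKL _ h₃.1, h₃.2⟩

theorem ConstructibleAux.bdryFace_or {n : ℕ} {K : PreAbstractSimplicialComplex V}
    (h : ConstructibleAux n K) {u : Finset V} (hu : Face K u) (hun : u.card + 1 = n) :
    BdryFace n K u ∨ ∃ s t, s ≠ t ∧ (Face K s ∧ s.card = n) ∧ (Face K t ∧ t.card = n) ∧
      u ⊆ s ∧ u ⊆ t := by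
  obtain ⟨s, hs, hsn, hus⟩ := h.exists_facet hu
  by_cases h' : ∃ t, s ≠ t ∧ (Face K t ∧ t.card = n) ∧ u ⊆ t
  · obtain ⟨t, hst, ht, hut⟩ := h'
    exact Or.inr ⟨s, t, hst, ⟨hs, hsn⟩, ht, hus, hut⟩
  · refine Or.inl ⟨hun, s, ⟨⟨hs, hsn⟩, hus⟩, fun t ht => ?_⟩
    by_contra hne
    exact h' ⟨t, Ne.symm hne, ht⟩

theorem ConstructibleAux.exists_pair {K : PreAbstractSimplicialComplex V}
    (h : ConstructibleAux 3 K) {e : Finset V} (he : Face K e)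
    (he2 : e.card = 2) (heb : ¬ BdryFace 3 K e) : ∃ s t, s ≠ t ∧ (Face K s ∧ s.card = 3) ∧
      (Face K t ∧ t.card = 3) ∧ e ⊆ s ∧ e ⊆ t :=
  (h.bdryFace_or he (by omega)).resolve_left heb

theorem ConstructibleAux.exists_fundamental {n : ℕ} {K : PreAbstractSimplicialComplex V}
    (h : ConstructibleAux n K) :
    ∃ F ∈ chains K n, ∀ s, Face K s → s.card = n → F s = 1 := by
  classical
  refine ⟨Finsupp.onFinset h.finite.toFinset (fun s => if Face K s ∧ s.card = n then 1 else 0) ?_,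
    mem_chains.2 ?_, ?_⟩
  · intro s hs
    simp only [ne_eq, ite_eq_right_iff, one_ne_zero, imp_false, not_not] at hs
    simpa using hs.1
  · intro s hs
    simpa using hs
  · intro s hs hsn
    simp [hs, hsn]

variable [DecidableEq V]

theorem bd_apply_of_bdryFace {n : ℕ} {K : PreAbstractSimplicialComplex V} {w : Finset V →₀ ZMod 2}
    (hw : w ∈ chains K n) {u s : Finset V} (hu : BdryFace n K u) (hs : Face K s) (hsn : s.card = n)
    (hus : u ⊆ s) : bd w u = w s := by
  obtain ⟨hun, s', hs', huniq⟩ := hu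
  obtain rfl : s = s' := huniq s ⟨⟨hs, hsn⟩, hus⟩
  rw [bd_apply, Finset.sum_eq_single s]
  · rw [if_pos ⟨hus, by omega⟩]
  · intro t ht hts
    refine if_neg fun h => hts (huniq t ⟨mem_chains.1 hw t (Finsupp.mem_support_iff.1 ht), h.1⟩)
  · intro h
    rw [if_pos ⟨hus, by omega⟩]
    simpa using h

theorem bd_apply_of_pair {n : ℕ} {K : PreAbstractSimplicialComplex V} (hK : IsPseudomanifold n K)
    {w : Finset V →₀ ZMod 2} (hw : w ∈ chains K n) {u s t : Finset V} (hun : u.card + 1 = n)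
    (hst : s ≠ t) (hs : Face K s ∧ s.card = n) (ht : Face K t ∧ t.card = n) (hus : u ⊆ s)
    (hut : u ⊆ t) : bd w u = w s + w t := by
  rw [bd_apply, ← Finset.sum_pair hst, Finset.sum_subset (Finset.subset_union_left (s₂ := {s, t})),
    ← Finset.sum_subset (Finset.subset_union_right (s₁ := w.support))]
  · refine Finset.sum_congr rfl fun r hr => ?_
    rw [Finset.mem_insert, Finset.mem_singleton] at hr
    rcases hr with rfl | rfl
    · rw [if_pos ⟨hus, by omega⟩]
    · rw [if_pos ⟨hut, by omega⟩]
  · intro r hr hr'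
    rw [Finset.mem_insert, Finset.mem_singleton, not_or] at hr'
    have hrw : w r ≠ 0 := by
      rcases Finset.mem_union.1 hr with h | h
      · simpa using h
      · simp [hr'.1, hr'.2] at h
    refine if_neg fun h => ?_
    rcases hK u r s t hun (mem_chains.1 hw r hrw) hs ht h.1 hus hut with h | h | h
    · exact hr'.1 h
    · exact hr'.2 h
    · exact hst h
  · intro r _ hr
    rw [Finsupp.mem_support_iff, not_not] at hr
    simp [hr]

/-- A vanishing boundary at a ridge in two facets forces equal coefficients on them, so strong
connectedness makes the coefficient constant. -/
theorem ConstructibleAux.eq_zero_or_eq_one {n : ℕ} {K : PreAbstractSimplicialComplex V}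
    (h : ConstructibleAux n K) (hK : IsPseudomanifold n K) {w : Finset V →₀ ZMod 2}
    (hw : w ∈ chains K n) (hb : ∀ u, bd w u ≠ 0 → BdryFace n K u) :
    w = 0 ∨ ∀ s, Face K s → s.card = n → w s = 1 := by
  by_cases hw0 : w = 0
  · exact Or.inl hw0
  · right
    obtain ⟨s, hs⟩ := Finsupp.ne_iff.1 hw0
    obtain ⟨hsf, hsn⟩ := mem_chains.1 hw s hs
    intro t ht htn
    refine zmod_two_eq_one (h.mem_of_adjacent {t | w t ≠ 0} ?_ hsf hsn hs ht htn)
    intro a b u ha hb' han hbn hun hua hub hwa hwb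
    have hab : a ≠ b := by
      rintro rfl
      exact hwa hwb
    have hu : bd w u ≠ 0 := by
      rw [bd_apply_of_pair hK hw hun hab ⟨ha, han⟩ ⟨hb', hbn⟩ hua hub, hwb, add_zero]
      exact hwa
    exact hab ((hb u hu).2.unique ⟨⟨ha, han⟩, hua⟩ ⟨⟨hb', hbn⟩, hub⟩)

/-- A cycle in the boundary of a constructible pseudomanifold is zero or the whole boundary. -/
theorem ConstructibleAux.cycle_eq_zero_or {n : ℕ} {K : PreAbstractSimplicialComplex V}
    (h : ConstructibleAux n K) (hK : IsPseudomanifold n K) {z : Finset V →₀ ZMod 2}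
    (hz : ∀ u, z u ≠ 0 → BdryFace n K u) (hz0 : bd z = 0) :
    z = 0 ∨ ∀ u, BdryFace n K u → z u = 1 := by
  rcases n with _ | n
  · left
    ext u
    by_contra hu
    exact absurd (hz u hu).1 (by omega)
  · obtain ⟨w, hw, rfl⟩ := h.exists_bd_eq (Nat.lt_succ_self n)
      (mem_chains.2 fun u hu => ⟨(hz u hu).face, by have := (hz u hu).1; omega⟩) hz0
    rcases h.eq_zero_or_eq_one hK hw hz with rfl | hw1
    · left; simp
    · right
      intro u hu
      obtain ⟨s, ⟨⟨hs, hsn⟩, hus⟩, -⟩ := hu.2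
      rw [bd_apply_of_bdryFace hw hu hs hsn hus, hw1 s hs hsn]

/-- The boundary of the fundamental chain of a constructible pseudomanifold. -/
theorem ConstructibleAux.bd_fundamental {n : ℕ} {K : PreAbstractSimplicialComplex V}
    (h : ConstructibleAux n K) (hK : IsPseudomanifold n K) {F : Finset V →₀ ZMod 2}
    (hF : F ∈ chains K n) (hF1 : ∀ s, Face K s → s.card = n → F s = 1) (u : Finset V) :
    bd F u ≠ 0 ↔ BdryFace n K u := by
  constructor
  · intro hu
    rcases n with _ | n
    · exfalso
      rw [bd_apply] at hu
      obtain ⟨s, hs, hsu⟩ := Finset.exists_ne_zero_of_sum_ne_zero hu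
      rw [Finsupp.mem_support_iff] at hs
      have := (mem_chains.1 hF s hs).2
      rw [if_neg (by omega)] at hsu
      exact hsu rfl
    · obtain ⟨hu1, hu2⟩ := mem_chains.1 (bd_mem_chains hF) u hu
      refine (h.bdryFace_or hu1 (by omega)).resolve_right ?_
      rintro ⟨s, t, hst, hs, ht, hus, hut⟩
      rw [bd_apply_of_pair hK hF (by omega) hst hs ht hus hut, hF1 s hs.1 hs.2,
        hF1 t ht.1 ht.2] at hu
      exact hu (ZModModule.add_self _)
  · intro hu
    obtain ⟨s, ⟨⟨hs, hsn⟩, hus⟩, -⟩ := hu.2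
    rw [bd_apply_of_bdryFace hF hu hs hsn hus, hF1 s hs hsn]
    exact one_ne_zero

end Pseudomanifold

/-! ### Links -/

section Link

variable {V : Type*} [DecidableEq V]

/-- The link of the face `g`. -/
def link (K : PreAbstractSimplicialComplex V) (g : Finset V) : PreAbstractSimplicialComplex V where
  faces := {t | t.Nonempty ∧ Disjoint t g ∧ t ∪ g ∈ K}
  isRelLowerSet_faces := fun _ ht => ⟨ht.1, fun _ hu hne => ⟨hne,
    Disjoint.mono_left hu ht.2.1, mem_of_subset ht.2.2 (Finset.union_subset_union_left hu)
      (hne.mono Finset.subset_union_left)⟩⟩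

theorem face_link {K : PreAbstractSimplicialComplex V} {g t : Finset V} (hg : Face K g) :
    Face (link K g) t ↔ Disjoint t g ∧ Face K (t ∪ g) := by
  have h : t ∈ link K g ↔ t.Nonempty ∧ Disjoint t g ∧ t ∪ g ∈ K := Iff.rfl
  rcases t.eq_empty_or_nonempty with rfl | ht
  · simp [Face, h]
    simpa [Face] using hg
  · simp only [Face, h, ht, true_and, ht.ne_empty, or_false]
    refine and_congr_right fun _ => ?_
    simp [Finset.union_eq_empty, ht.ne_empty]

theorem link_inf (K L : PreAbstractSimplicialComplex V) (g : Finset V) :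
    link (K ⊓ L) g = link K g ⊓ link L g := by
  refine SetLike.ext fun t => ?_
  change (t.Nonempty ∧ Disjoint t g ∧ t ∪ g ∈ K ∧ t ∪ g ∈ L) ↔
    (t.Nonempty ∧ Disjoint t g ∧ t ∪ g ∈ K) ∧ (t.Nonempty ∧ Disjoint t g ∧ t ∪ g ∈ L)
  tauto

theorem link_sup (K L : PreAbstractSimplicialComplex V) (g : Finset V) :
    link (K ⊔ L) g = link K g ⊔ link L g := by
  refine SetLike.ext fun t => ?_
  change (t.Nonempty ∧ Disjoint t g ∧ (t ∪ g ∈ K ∨ t ∪ g ∈ L)) ↔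
    (t.Nonempty ∧ Disjoint t g ∧ t ∪ g ∈ K) ∨ (t.Nonempty ∧ Disjoint t g ∧ t ∪ g ∈ L)
  tauto

theorem link_eq_bot {K : PreAbstractSimplicialComplex V} {g : Finset V} (hg : ¬ Face K g) :
    link K g = ⊥ := by
  refine SetLike.ext fun t => ⟨fun h => hg ?_, fun h => h.elim⟩
  exact Face.subset (Or.inl h.2.2) Finset.subset_union_right

theorem link_simplex {s g : Finset V} (hg : g ⊆ s) : link (simplex s) g = simplex (s \ g) := by
  refine SetLike.ext fun t => ?_
  change (t.Nonempty ∧ Disjoint t g ∧ (t ∪ g).Nonempty ∧ t ∪ g ⊆ s) ↔ t.Nonempty ∧ t ⊆ s \ g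
  rw [Finset.subset_sdiff, Finset.union_subset_iff]
  constructor
  · rintro ⟨h1, h2, -, h3⟩
    exact ⟨h1, h3.1, h2⟩
  · rintro ⟨h1, h2, h3⟩
    exact ⟨h1, h3, h1.mono Finset.subset_union_left, h2, hg⟩

theorem ConstructibleAux.link {n : ℕ} {K : PreAbstractSimplicialComplex V}
    (h : ConstructibleAux n K) {m : ℕ} {g : Finset V} (hg : Face K g) (hn : n = m + g.card) :
    ConstructibleAux m (link K g) := by
  induction h generalizing m with
  | simplex s =>
    have hgs := face_simplex.1 hg
    rw [link_simplex hgs]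
    have : m = (s \ g).card := by rw [Finset.card_sdiff_of_subset hgs]; omega
    rw [this]
    exact ConstructibleAux.simplex _
  | @union n K₁ K₂ h₁ h₂ h ih₁ ih₂ ih =>
    rw [link_sup]
    by_cases hg₁ : Face K₁ g <;> by_cases hg₂ : Face K₂ g
    · have hgM := face_inf.2 ⟨hg₁, hg₂⟩
      -- A face of the intersection has at most `n` elements, so `m` is positive and the union
      -- constructor applies to the links.
      have := h.card_le hgM
      obtain ⟨m, rfl⟩ : ∃ k, m = k + 1 := ⟨m - 1, by omega⟩
      refine ConstructibleAux.union (ih₁ hg₁ hn) (ih₂ hg₂ hn) ?_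
      rw [← link_inf]
      exact ih hgM (by omega)
    · rw [link_eq_bot hg₂, sup_bot_eq]
      exact ih₁ hg₁ hn
    · rw [link_eq_bot hg₁, bot_sup_eq]
      exact ih₂ hg₂ hn
    · exact absurd (face_sup.1 hg) (by tauto)

theorem IsPseudomanifold.link {m : ℕ} {K : PreAbstractSimplicialComplex V} {g : Finset V}
    (hK : IsPseudomanifold (m + g.card) K) (hg : Face K g) : IsPseudomanifold m (link K g) := by
  intro u s₁ s₂ s₃ hu h₁ h₂ h₃ hu₁ hu₂ hu₃
  rw [face_link hg] at h₁ h₂ h₃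
  have key : ∀ s : Finset V, (Disjoint s g ∧ Face K (s ∪ g)) ∧ s.card = m →
      Face K (s ∪ g) ∧ (s ∪ g).card = m + g.card := fun s hs =>
    ⟨hs.1.2, by rw [Finset.card_union_of_disjoint hs.1.1, hs.2]⟩
  have inj : ∀ s t : Finset V, Disjoint s g → Disjoint t g → s ∪ g = t ∪ g → s = t := by
    intro s t hs ht h
    rw [← Finset.union_sdiff_cancel_right hs, h, Finset.union_sdiff_cancel_right ht]
  have := hK (u ∪ g) (s₁ ∪ g) (s₂ ∪ g) (s₃ ∪ g)
    (by rw [Finset.card_union_of_disjoint (Disjoint.mono_left hu₁ h₁.1.1)]; omega)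
    (key _ h₁) (key _ h₂) (key _ h₃) (Finset.union_subset_union_left hu₁)
    (Finset.union_subset_union_left hu₂) (Finset.union_subset_union_left hu₃)
  rcases this with h | h | h
  · exact Or.inl (inj _ _ h₁.1.1 h₂.1.1 h)
  · exact Or.inr (Or.inl (inj _ _ h₁.1.1 h₃.1.1 h))
  · exact Or.inr (Or.inr (inj _ _ h₂.1.1 h₃.1.1 h))

theorem bdryFace_link {m : ℕ} {K : PreAbstractSimplicialComplex V} {g u : Finset V}
    (hg : Face K g) (hu : Disjoint u g) :
    BdryFace m (link K g) u ↔ BdryFace (m + g.card) K (u ∪ g) := by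
  have hc : (u ∪ g).card = u.card + g.card := Finset.card_union_of_disjoint hu
  refine and_congr (by omega) ⟨?_, ?_⟩
  · rintro ⟨s, ⟨⟨hs, hsm⟩, hus⟩, huniq⟩
    rw [face_link hg] at hs
    refine ⟨s ∪ g, ⟨⟨hs.2, by rw [Finset.card_union_of_disjoint hs.1, hsm]⟩,
      Finset.union_subset_union_left hus⟩, ?_⟩
    rintro t ⟨⟨ht, htm⟩, hut⟩
    have hgt : g ⊆ t := Finset.subset_union_right.trans hut
    rw [← huniq (t \ g) ⟨⟨(face_link hg).2 ⟨Finset.sdiff_disjoint,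
      by rwa [Finset.sdiff_union_of_subset hgt]⟩, by
        rw [Finset.card_sdiff_of_subset hgt]; omega⟩,
      Finset.subset_sdiff.2 ⟨Finset.subset_union_left.trans hut, hu⟩⟩]
    rw [Finset.sdiff_union_of_subset hgt]
  · rintro ⟨s, ⟨⟨hs, hsm⟩, hus⟩, huniq⟩
    have hgs : g ⊆ s := Finset.subset_union_right.trans hus
    refine ⟨s \ g, ⟨⟨(face_link hg).2 ⟨Finset.sdiff_disjoint,
      by rwa [Finset.sdiff_union_of_subset hgs]⟩, by
        rw [Finset.card_sdiff_of_subset hgs]; omega⟩,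
      Finset.subset_sdiff.2 ⟨Finset.subset_union_left.trans hus, hu⟩⟩, ?_⟩
    rintro t ⟨⟨ht, htm⟩, hut⟩
    rw [face_link hg] at ht
    rw [← huniq (t ∪ g) ⟨⟨ht.2, by rw [Finset.card_union_of_disjoint ht.1, htm]⟩,
      Finset.union_subset_union_left hut⟩, Finset.union_sdiff_cancel_right ht.1]

theorem exists_bdryFace_link {m : ℕ} {K : PreAbstractSimplicialComplex V} {g : Finset V}
    (hg : Face K g) :
    (∃ u, BdryFace m (link K g) u) ↔ ∃ u, BdryFace (m + g.card) K u ∧ g ⊆ u := by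
  constructor
  · rintro ⟨u, hu⟩
    have hd := ((face_link hg).1 hu.face).1
    exact ⟨u ∪ g, (bdryFace_link hg hd).1 hu, Finset.subset_union_right⟩
  · rintro ⟨u, hu, hgu⟩
    refine ⟨u \ g, (bdryFace_link hg Finset.sdiff_disjoint).2 ?_⟩
    rwa [Finset.sdiff_union_of_subset hgu]

end Link

/-! ### The dividing complex of a decomposition -/

section Split

variable {V : Type*}

/-- A decomposition of a constructible pseudomanifold into constructible pieces. -/
structure IsSplit (n : ℕ) (K₁ K₂ : PreAbstractSimplicialComplex V) : Prop where
  left : ConstructibleAux (n + 1) K₁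
  right : ConstructibleAux (n + 1) K₂
  inter : ConstructibleAux n (K₁ ⊓ K₂)
  pm : IsPseudomanifold (n + 1) (K₁ ⊔ K₂)

namespace IsSplit

variable {n : ℕ} {K₁ K₂ : PreAbstractSimplicialComplex V}

theorem symm (h : IsSplit n K₁ K₂) : IsSplit n K₂ K₁ :=
  ⟨h.right, h.left, inf_comm K₁ K₂ ▸ h.inter, sup_comm K₁ K₂ ▸ h.pm⟩

theorem union (h : IsSplit n K₁ K₂) : ConstructibleAux (n + 1) (K₁ ⊔ K₂) :=
  h.left.union h.right h.inter

theorem pm_left (h : IsSplit n K₁ K₂) : IsPseudomanifold (n + 1) K₁ :=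
  h.pm.mono fun _ hs => face_sup.2 (Or.inl hs)

/-- A facet common to both pieces would be a face of the intersection with one element too many. -/
theorem exists_facets (h : IsSplit n K₁ K₂) {u : Finset V} (hu : Face (K₁ ⊓ K₂) u) :
    ∃ s₁ s₂, s₁ ≠ s₂ ∧ (Face K₁ s₁ ∧ s₁.card = n + 1) ∧ (Face K₂ s₂ ∧ s₂.card = n + 1) ∧
      u ⊆ s₁ ∧ u ⊆ s₂ := by
  obtain ⟨s₁, h₁, hn₁, hu₁⟩ := h.left.exists_facet (face_inf.1 hu).1
  obtain ⟨s₂, h₂, hn₂, hu₂⟩ := h.right.exists_facet (face_inf.1 hu).2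
  refine ⟨s₁, s₂, ?_, ⟨h₁, hn₁⟩, ⟨h₂, hn₂⟩, hu₁, hu₂⟩
  rintro rfl
  have := h.inter.card_le (face_inf.2 ⟨h₁, h₂⟩)
  omega

/-- Each side occupies one of the at most two facets at `u`, which leaves no room for a second one
in `K₁`. -/
theorem bdryFace_left (h : IsSplit n K₁ K₂) {u : Finset V} (hu : Face (K₁ ⊓ K₂) u)
    (hun : u.card = n) : BdryFace (n + 1) K₁ u := by
  obtain ⟨s₁, s₂, hne, h₁, h₂, hu₁, hu₂⟩ := h.exists_facets hu
  refine ⟨by omega, s₁, ⟨h₁, hu₁⟩, ?_⟩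
  rintro t ⟨ht, hut⟩
  rcases h.pm u t s₁ s₂ (by omega) ⟨face_sup.2 (Or.inl ht.1), ht.2⟩
    ⟨face_sup.2 (Or.inl h₁.1), h₁.2⟩ ⟨face_sup.2 (Or.inr h₂.1), h₂.2⟩ hut hu₁ hu₂ with e | e | e
  · exact e
  · subst e
    have := h.inter.card_le (face_inf.2 ⟨ht.1, h₂.1⟩)
    omega
  · exact absurd e hne

theorem not_bdryFace (h : IsSplit n K₁ K₂) {u : Finset V} (hu : Face (K₁ ⊓ K₂) u) :
    ¬ BdryFace (n + 1) (K₁ ⊔ K₂) u := by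
  intro hb
  obtain ⟨s₁, s₂, hne, h₁, h₂, hu₁, hu₂⟩ := h.exists_facets hu
  exact hne (hb.2.unique ⟨⟨face_sup.2 (Or.inl h₁.1), h₁.2⟩, hu₁⟩
    ⟨⟨face_sup.2 (Or.inr h₂.1), h₂.2⟩, hu₂⟩)

theorem bdryFace_of_union (h : IsSplit n K₁ K₂) {u : Finset V}
    (hu : BdryFace (n + 1) (K₁ ⊔ K₂) u) (hu₁ : Face K₁ u) : BdryFace (n + 1) K₁ u := by
  obtain ⟨hun, s, -, huniq⟩ := hu
  obtain ⟨t, ht, htn, hut⟩ := h.left.exists_facet hu₁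
  exact ⟨hun, t, ⟨⟨ht, htn⟩, hut⟩, fun r hr =>
    (huniq r ⟨⟨face_sup.2 (Or.inl hr.1.1), hr.1.2⟩, hr.2⟩).trans
      (huniq t ⟨⟨face_sup.2 (Or.inl ht), htn⟩, hut⟩).symm⟩

theorem bdryFace_union_or {u : Finset V} (h : BdryFace n K₁ u) :
    BdryFace n (K₁ ⊔ K₂) u ∨ Face K₂ u := by
  by_cases hu : Face K₂ u
  · exact Or.inr hu
  · left
    obtain ⟨hun, s, ⟨⟨hs, hsn⟩, hus⟩, huniq⟩ := h
    refine ⟨hun, s, ⟨⟨face_sup.2 (Or.inl hs), hsn⟩, hus⟩, ?_⟩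
    rintro t ⟨⟨ht, htn⟩, hut⟩
    exact huniq t ⟨⟨(face_sup.1 ht).resolve_right fun h => hu (h.subset hut), htn⟩, hut⟩

variable [DecidableEq V]

theorem link {m : ℕ} {g : Finset V} (h : IsSplit (m + g.card) K₁ K₂) (hg : Face (K₁ ⊓ K₂) g) :
    IsSplit m (link K₁ g) (link K₂ g) where
  left := h.left.link (face_inf.1 hg).1 (by omega)
  right := h.right.link (face_inf.1 hg).2 (by omega)
  inter := by
    rw [← link_inf]
    exact h.inter.link hg rfl
  pm := by
    rw [← link_sup]
    refine IsPseudomanifold.link ?_ (face_sup.2 (Or.inl (face_inf.1 hg).1))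
    have := h.pm
    rwa [show m + 1 + g.card = m + g.card + 1 by omega]

/-- Here `K₁` is a connected graph of degree at most two, and the points of the intersection are
ends of it. The sum of two ends is a cycle for the augmented boundary, so it is the whole boundary
and there is no third end. -/
theorem pm_inter_one (h : IsSplit 1 K₁ K₂) : IsPseudomanifold 1 (K₁ ⊓ K₂) := by
  intro u s₁ s₂ s₃ hu h₁ h₂ h₃ _ _ _
  by_contra! hne
  obtain ⟨h12, h13, h23⟩ := hne
  have hb := fun s (hs : Face (K₁ ⊓ K₂) s ∧ s.card = 1) => h.bdryFace_left hs.1 hs.2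
  have hz : bd (Finsupp.single s₁ (1 : ZMod 2) + Finsupp.single s₂ 1) = 0 := by
    obtain ⟨a, rfl⟩ := Finset.card_eq_one.1 h₁.2
    obtain ⟨b, rfl⟩ := Finset.card_eq_one.1 h₂.2
    rw [map_add, bd_single, bd_single]
    simpa using ZModModule.add_self _
  have hzb : ∀ r,
      (Finsupp.single s₁ (1 : ZMod 2) + Finsupp.single s₂ 1 : Finset V →₀ ZMod 2) r ≠ 0 →
        BdryFace (1 + 1) K₁ r := by
    intro r hr
    by_cases hr1 : r = s₁
    · exact hr1 ▸ hb _ h₁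
    · by_cases hr2 : r = s₂
      · exact hr2 ▸ hb _ h₂
      · rw [Finsupp.add_apply, Finsupp.single_eq_of_ne hr1, Finsupp.single_eq_of_ne hr2] at hr
        simp at hr
  rcases h.left.cycle_eq_zero_or h.pm_left hzb hz with h0 | h1
  · have := DFunLike.congr_fun h0 s₁
    simp [h12.symm] at this
  · have := h1 s₃ (hb _ h₃)
    rw [Finsupp.add_apply, Finsupp.single_eq_of_ne h13.symm,
      Finsupp.single_eq_of_ne h23.symm] at this
    simp at this

/-- The link of the ridge `u` turns the pieces into graphs, where `pm_inter_one` applies. -/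
theorem pm_inter (h : IsSplit n K₁ K₂) : IsPseudomanifold n (K₁ ⊓ K₂) := by
  intro u s₁ s₂ s₃ hun h₁ h₂ h₃ hu₁ hu₂ hu₃
  have hu := h₁.1.subset hu₁
  obtain rfl : n = 1 + u.card := by omega
  have hl := (h.link hu).pm_inter_one
  rw [← link_inf] at hl
  have key : ∀ s : Finset V, Face (K₁ ⊓ K₂) s ∧ s.card = 1 + u.card → u ⊆ s →
      Face (SimplicialBall.link (K₁ ⊓ K₂) u) (s \ u) ∧ (s \ u).card = 1 := fun s hs hus =>
    ⟨(face_link hu).2 ⟨Finset.sdiff_disjoint, by rw [Finset.sdiff_union_of_subset hus]; exact hs.1⟩,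
      by rw [Finset.card_sdiff_of_subset hus]; omega⟩
  have inj : ∀ s t : Finset V, u ⊆ s → u ⊆ t → s \ u = t \ u → s = t := by
    intro s t hs ht h
    rw [← Finset.sdiff_union_of_subset hs, h, Finset.sdiff_union_of_subset ht]
  rcases hl ∅ _ _ _ rfl (key s₁ h₁ hu₁) (key s₂ h₂ hu₂) (key s₃ h₃ hu₃) (by simp) (by simp)
    (by simp) with e | e | e
  · exact Or.inl (inj _ _ hu₁ hu₂ e)
  · exact Or.inr (Or.inl (inj _ _ hu₁ hu₃ e))
  · exact Or.inr (Or.inr (inj _ _ hu₂ hu₃ e))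

/-- If the dividing complex were closed, its fundamental cycle would be the entire boundary of each
piece. A boundary face of the union would then lie in the dividing complex, where no ridge is a
boundary face. -/
theorem exists_bdryFace_of_union (h : IsSplit n K₁ K₂)
    (hb : ∃ u, BdryFace (n + 1) (K₁ ⊔ K₂) u) : ∃ u, BdryFace n (K₁ ⊓ K₂) u := by
  by_contra hD
  obtain ⟨F, hF, hF1⟩ := h.inter.exists_fundamental
  have hF0 : bd F = 0 := by
    ext u
    by_contra hu
    exact hD ⟨u, (h.inter.bd_fundamental h.pm_inter hF hF1 u).1 hu⟩
  have key : ∀ L₁ L₂ : PreAbstractSimplicialComplex V, IsSplit n L₁ L₂ → L₁ ⊓ L₂ = K₁ ⊓ K₂ →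
      ∀ u, BdryFace (n + 1) (L₁ ⊔ L₂) u → ¬ Face L₁ u := by
    intro L₁ L₂ hL hi u hu hu₁
    have hFb : ∀ r, F r ≠ 0 → BdryFace (n + 1) L₁ r := fun r hr =>
      hL.bdryFace_left (hi ▸ (mem_chains.1 hF r hr).1) (mem_chains.1 hF r hr).2
    rcases hL.left.cycle_eq_zero_or hL.pm_left hFb hF0 with h0 | h1
    · obtain ⟨s, hs, hsn, -⟩ := h.inter.exists_facet (face_empty _)
      have := hF1 s hs hsn
      simp [h0] at this
    · have := h1 u (hL.bdryFace_of_union hu hu₁)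
      refine hL.not_bdryFace (u := u) ?_ hu
      rw [hi]
      exact (mem_chains.1 hF u (by simp [this])).1
  obtain ⟨u, hu⟩ := hb
  rcases face_sup.1 hu.face with hu' | hu'
  · exact key K₁ K₂ h rfl u hu hu'
  · exact key K₂ K₁ h.symm (inf_comm _ _) u (sup_comm K₁ K₂ ▸ hu) hu'

/-- If the union were closed, the boundary of `K₁` would be exactly the dividing complex, which is
then a boundary and hence closed. -/
theorem exists_bdryFace_union (h : IsSplit n K₁ K₂)
    (hb : ∃ u, BdryFace n (K₁ ⊓ K₂) u) : ∃ u, BdryFace (n + 1) (K₁ ⊔ K₂) u := by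
  by_contra hK
  obtain ⟨F, hF, hF1⟩ := h.inter.exists_fundamental
  obtain ⟨G, hG, hG1⟩ := h.left.exists_fundamental
  have hGF : bd G = F := by
    ext u
    by_cases hu : BdryFace (n + 1) K₁ u
    · have hu2 : Face K₂ u := (bdryFace_union_or hu).resolve_left fun h => hK ⟨u, h⟩
      rw [zmod_two_eq_one ((h.left.bd_fundamental h.pm_left hG hG1 u).2 hu),
        hF1 u (face_inf.2 ⟨hu.face, hu2⟩) (by have := hu.1; omega)]
    · have h0 : F u = 0 := by
        by_contra h0
        have := mem_chains.1 hF u h0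
        exact hu (h.bdryFace_left this.1 this.2)
      rw [h0]
      by_contra h1
      exact hu ((h.left.bd_fundamental h.pm_left hG hG1 u).1 h1)
  obtain ⟨u, hu⟩ := hb
  refine (h.inter.bd_fundamental h.pm_inter hF hF1 u).2 hu ?_
  rw [← hGF, bd_bd, Finsupp.zero_apply]

/-- The boundary of the dividing complex is its intersection with the boundary. -/
theorem inter_bdry_iff (h : IsSplit n K₁ K₂) {g : Finset V} (hg : Face (K₁ ⊓ K₂) g) :
    (∃ u, BdryFace n (K₁ ⊓ K₂) u ∧ g ⊆ u) ↔ ∃ u, BdryFace (n + 1) (K₁ ⊔ K₂) u ∧ g ⊆ u := by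
  -- In the link of `g`, both sides merely assert that some boundary face exists.
  obtain ⟨m, rfl⟩ : ∃ m, n = m + g.card := ⟨n - g.card, by have := h.inter.card_le hg; omega⟩
  have hl := h.link hg
  rw [← exists_bdryFace_link hg, show m + g.card + 1 = m + 1 + g.card by omega,
    ← exists_bdryFace_link (face_sup.2 (Or.inl (face_inf.1 hg).1)), link_inf, link_sup]
  exact ⟨hl.exists_bdryFace_union, hl.exists_bdryFace_of_union⟩

end IsSplit

end Split

/-! ### Chords of constructible surfaces -/

section Disk

variable {V : Type*} [DecidableEq V] {K : PreAbstractSimplicialComplex V}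

theorem bd_single_pair {a b : V} (hab : a ≠ b) :
    bd (Finsupp.single ({a, b} : Finset V) (1 : ZMod 2)) =
      Finsupp.single {a} 1 + Finsupp.single {b} 1 := by
  rw [bd_single, Finset.sum_pair hab, Finset.erase_insert (by simpa using hab), Finset.pair_comm,
    Finset.erase_insert (by simpa using hab.symm), add_comm]

/-- The boundary graph of a constructible surface is connected: a vertex set that is closed under
adjacency and contains a boundary vertex contains them all. -/
theorem ConstructibleAux.bdry_connected (h : ConstructibleAux 3 K) (hK : IsPseudomanifold 3 K)
    (S : Set V) (hS : ∀ g, BdryFace 3 K g → ∀ a ∈ g, ∀ b ∈ g, a ∈ S → b ∈ S) {a b : V}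
    {g g' : Finset V} (hg : BdryFace 3 K g) (hag : a ∈ g) (haS : a ∈ S) (hg' : BdryFace 3 K g')
    (hbg : b ∈ g') : b ∈ S := by
  classical
  obtain ⟨F, hF, hF1⟩ := h.exists_fundamental
  have hbF := h.bd_fundamental hK hF hF1
  -- No boundary edge joins `S` to its complement, so the part of the boundary cycle that meets `S`
  -- is itself a cycle, hence zero or everything.
  set z := (bd F).filter fun g => ∃ x ∈ g, x ∈ S with hz
  set z' := (bd F).filter fun g => ¬ ∃ x ∈ g, x ∈ S with hz'
  have hsum : bd z + bd z' = 0 := by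
    rw [← map_add, hz, hz', Finsupp.filter_add_filter_not, bd_bd]
  have hz0 : bd z = 0 := by
    ext u
    rw [Finsupp.zero_apply]
    by_cases hu : ∃ x ∈ u, x ∈ S
    · have h1 : bd z' u = 0 := by
        rw [bd_apply]
        refine Finset.sum_eq_zero fun s hs => if_neg fun hus => ?_
        rw [Finsupp.mem_support_iff, hz', Finsupp.filter_apply] at hs
        obtain ⟨x, hxu, hxS⟩ := hu
        exact hs (if_neg fun hn => hn ⟨x, hus.1 hxu, hxS⟩)
      have := DFunLike.congr_fun hsum u
      simpa [h1] using this
    · rw [bd_apply]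
      refine Finset.sum_eq_zero fun s hs => if_neg fun hus => ?_
      rw [Finsupp.mem_support_iff, hz, Finsupp.filter_apply] at hs
      split_ifs at hs with hsS
      · obtain ⟨x, hxs, hxS⟩ := hsS
        have hb := (hbF s).1 hs
        have hc := hb.1
        obtain ⟨y, hy⟩ : u.Nonempty := Finset.card_pos.1 (by omega)
        exact hu ⟨y, hy, hS s hb x hxs y (hus.1 hy) hxS⟩
      · exact hs rfl
  have hzb : ∀ u, z u ≠ 0 → BdryFace 3 K u := by
    intro u hu
    rw [hz, Finsupp.filter_apply] at hu
    split_ifs at hu with hs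
    · exact (hbF u).1 hu
    · exact absurd rfl hu
  rcases h.cycle_eq_zero_or hK hzb hz0 with h0 | h1
  · exfalso
    have := DFunLike.congr_fun h0 g
    rw [hz, Finsupp.filter_apply, if_pos ⟨a, hag, haS⟩] at this
    exact (hbF g).2 hg this
  · have := h1 g' hg'
    rw [hz, Finsupp.filter_apply] at this
    split_ifs at this with hs
    · obtain ⟨x, hx, hxS⟩ := hs
      exact hS g' hg' x hx b hbg hxS
    · simp at this

/-- The number of edges of a `1`-cycle that leave a given vertex set is not one. -/
theorem mem_of_bd_eq_zero {z : Finset V →₀ ZMod 2} (hz : bd z = 0) (hz2 : ∀ g, z g ≠ 0 → g.card = 2)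
    (S : Set V) {v w : V} (hvw : v ≠ w) (he : z {v, w} ≠ 0)
    (hS : ∀ g, z g ≠ 0 → g ≠ {v, w} → ∀ a ∈ g, ∀ b ∈ g, a ∈ S → b ∈ S) (hv : v ∈ S) : w ∈ S := by
  classical
  by_contra hw
  -- `φ` counts, modulo 2, the vertices lying in `S`. It kills `bd z`, yet `{v, w}` would contribute
  -- one and every other edge zero.
  set φ : (Finset V →₀ ZMod 2) →ₗ[ZMod 2] ZMod 2 :=
    Finsupp.linearCombination (ZMod 2) fun g => if ∃ x ∈ S, g = {x} then 1 else 0 with hφ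
  have hφ1 : ∀ x, φ (Finsupp.single {x} 1) = if x ∈ S then 1 else 0 := by
    intro x
    have : (∃ y ∈ S, ({x} : Finset V) = {y}) ↔ x ∈ S := by
      simp only [Finset.singleton_inj]
      exact ⟨fun ⟨y, hy, hxy⟩ => hxy ▸ hy, fun hx => ⟨x, hx, rfl⟩⟩
    simp only [hφ, Finsupp.linearCombination_single, this, one_smul]
  have hφ2 : ∀ a b : V, a ≠ b → φ (bd (Finsupp.single {a, b} 1)) =
      (if a ∈ S then 1 else 0) + if b ∈ S then 1 else 0 := by
    intro a b hab
    rw [bd_single_pair hab, map_add, hφ1, hφ1]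
  have hsum : φ (bd z) = ∑ g ∈ z.support, z g • φ (bd (Finsupp.single g 1)) := by
    conv_lhs => rw [← Finsupp.sum_single z, Finsupp.sum]
    rw [map_sum, map_sum]
    refine Finset.sum_congr rfl fun g _ => ?_
    rw [← map_smul, ← map_smul, Finsupp.smul_single_one]
  rw [Finset.sum_eq_single {v, w}, hφ2 v w hvw, if_pos hv, if_neg hw, hz, map_zero,
    zmod_two_eq_one he] at hsum
  · simp at hsum
  · intro g hg hgne
    rw [Finsupp.mem_support_iff] at hg
    obtain ⟨a, b, hab, rfl⟩ := Finset.card_eq_two.1 (hz2 g hg)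
    have h1 := hS _ hg hgne a (by simp) b (by simp)
    have h2 := hS _ hg hgne b (by simp) a (by simp)
    rw [hφ2 a b hab]
    by_cases ha : a ∈ S
    · rw [if_pos ha, if_pos (h1 ha), ZModModule.add_self, smul_zero]
    · rw [if_neg ha, if_neg (fun hb => ha (h2 hb)), add_zero, smul_zero]
  · intro h0
    exact absurd (Finsupp.mem_support_iff.2 he) h0

theorem ConstructibleAux.exists_path (h : ConstructibleAux 3 K) (hK : IsPseudomanifold 3 K)
    {v w : V} (hv : ∃ g, BdryFace 3 K g ∧ v ∈ g) (hw : ∃ g, BdryFace 3 K g ∧ w ∈ g) :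
    ∃ c : Finset V →₀ ZMod 2, (∀ g, c g ≠ 0 → BdryFace 3 K g) ∧
      bd c = Finsupp.single {v} 1 + Finsupp.single {w} 1 := by
  obtain ⟨g, hg, hvg⟩ := hv
  obtain ⟨g', hg', hwg⟩ := hw
  refine h.bdry_connected hK {w | ∃ c : Finset V →₀ ZMod 2, (∀ g, c g ≠ 0 → BdryFace 3 K g) ∧
      bd c = Finsupp.single {v} 1 + Finsupp.single {w} 1} ?_ hg hvg ?_ hg' hwg
  · rintro g hg a ha b hb ⟨c, hc, hcb⟩
    by_cases hab : a = b
    · exact hab ▸ ⟨c, hc, hcb⟩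
    have hgab : {a, b} = g := Finset.eq_of_subset_of_card_le
      (Finset.insert_subset ha (by simpa using hb))
      (by have := hg.1; rw [Finset.card_pair hab]; omega)
    refine ⟨c + Finsupp.single g 1, fun r hr => ?_, ?_⟩
    · by_cases hrg : r = g
      · exact hrg ▸ hg
      · rw [Finsupp.add_apply, Finsupp.single_eq_of_ne hrg, add_zero] at hr
        exact hc r hr
    · rw [map_add, hcb, ← hgab, bd_single_pair hab, add_assoc,
        ← add_assoc (Finsupp.single ({a} : Finset V) _),
        ZModModule.add_self, zero_add]
  · exact ⟨0, by simp, by rw [map_zero, ZModModule.add_self]⟩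

/-- The edge `e` cuts off the triangles of `T`. -/
structure CutsOff (K : PreAbstractSimplicialComplex V) (e : Finset V) (T : Finset V →₀ ZMod 2) :
    Prop where
  mem : T ∈ chains K 3
  ne : bd T e ≠ 0
  bdry : ∀ u, bd T u ≠ 0 → u = e ∨ BdryFace 3 K u

/-- An interior edge with both ends in the boundary. -/
structure IsChord (K : PreAbstractSimplicialComplex V) (e : Finset V) : Prop where
  face : Face K e
  card : e.card = 2
  not_bdry : ¬ BdryFace 3 K e
  ends : ∀ v ∈ e, ∃ g, BdryFace 3 K g ∧ v ∈ g

/-- The chord together with a boundary path between its ends is a cycle, and any filling of it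
serves as `T`. -/
theorem IsChord.exists_cutsOff {e : Finset V} (he : IsChord K e) (h : ConstructibleAux 3 K)
    (hK : IsPseudomanifold 3 K) : ∃ T, CutsOff K e T := by
  obtain ⟨v, w, hvw, rfl⟩ := Finset.card_eq_two.1 he.card
  obtain ⟨c, hc, hcb⟩ := h.exists_path hK (he.ends v (by simp)) (he.ends w (by simp))
  obtain ⟨T, hT, hTb⟩ := h.exists_bd_eq (k := 2) (by omega) (z := c + Finsupp.single {v, w} 1)
    (Submodule.add_mem _ (mem_chains.2 fun g hg => ⟨(hc g hg).face, by have := (hc g hg).1; omega⟩)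
      (single_mem_chains he.face he.card)) (by
      rw [map_add, hcb, bd_single_pair hvw, ZModModule.add_self])
  refine ⟨T, hT, ?_, fun u hu => ?_⟩
  · have : c {v, w} = 0 := by
      by_contra h0
      exact he.not_bdry (hc _ h0)
    rw [hTb, Finsupp.add_apply, this]
    simp
  · by_cases hue : u = {v, w}
    · exact Or.inl hue
    · rw [hTb, Finsupp.add_apply, Finsupp.single_eq_of_ne hue, add_zero] at hu
      exact Or.inr (hc u hu)

/-- Intersect `T` with the side of `f` that omits the triangle of `T` at `e`. Both triangles at `e`
drop out or are outside that side, so `e` leaves the boundary; at `f` the chain `T` takes the value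
one on both triangles, so `f` stays. -/
theorem CutsOff.exists_smaller {e f : Finset V} {T T₂ : Finset V →₀ ZMod 2}
    (h : ConstructibleAux 3 K) (hK : IsPseudomanifold 3 K) (hT : CutsOff K e T)
    (hT₂ : CutsOff K f T₂) (he : IsChord K e) (hf : IsChord K f) (hfe : f ≠ e) {t : Finset V}
    (ht : T t ≠ 0) (hft : f ⊆ t) :
    ∃ T₃, CutsOff K f T₃ ∧ T₃.support.card < T.support.card := by
  classical
  obtain ⟨s, s', hss, hs, hs', hes, hes'⟩ := h.exists_pair he.face he.card he.not_bdry
  have he3 : e.card + 1 = 3 := by have := he.card; omega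
  have hf3 : f.card + 1 = 3 := by have := hf.card; omega
  have hTe := hT.ne
  rw [bd_apply_of_pair hK hT.mem he3 hss hs hs' hes hes'] at hTe
  wlog hTs : T s ≠ 0 generalizing s s'
  · rw [not_not] at hTs
    refine this s' s hss.symm hs' hs hes' hes (by rwa [add_comm]) ?_
    rwa [hTs, zero_add] at hTe
  -- Adding the fundamental chain passes to the other side of `f`.
  wlog hT2s : T₂ s = 0 generalizing T₂
  · obtain ⟨F, hF, hF1⟩ := h.exists_fundamental
    have hbF := h.bd_fundamental hK hF hF1
    refine this (T₂ := T₂ + F) ⟨Submodule.add_mem _ hT₂.mem hF, ?_, fun u hu => ?_⟩ ?_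
    · have : bd F f = 0 := by
        by_contra h0
        exact hf.not_bdry ((hbF f).1 h0)
      rw [map_add, Finsupp.add_apply, this, add_zero]
      exact hT₂.ne
    · by_cases hub : BdryFace 3 K u
      · exact Or.inr hub
      · have : bd F u = 0 := by
          by_contra h0
          exact hub ((hbF u).1 h0)
        rw [map_add, Finsupp.add_apply, this, add_zero] at hu
        exact hT₂.bdry u hu
    · rw [Finsupp.add_apply, hF1 s hs.1 hs.2, zmod_two_eq_one hT2s]
      exact ZModModule.add_self _
  have hval : ∀ r, (T.filter fun r => T₂ r ≠ 0) r = T r * T₂ r := by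
    intro r
    rw [Finsupp.filter_apply]
    split_ifs with h0
    · rw [zmod_two_eq_one h0, mul_one]
    · rw [not_not.1 h0, mul_zero]
  have hmem : (T.filter fun r => T₂ r ≠ 0) ∈ chains K 3 := by
    refine mem_chains.2 fun r hr => mem_chains.1 hT.mem r fun h0 => hr ?_
    rw [hval, h0, zero_mul]
  have add_eq : ∀ a b : ZMod 2, a + b = 0 → a = b := by decide
  have add_ne : ∀ a b : ZMod 2, a + b ≠ 0 → a ≠ b := by decide
  have hTf : bd T f = 0 := by
    by_contra h0
    exact (hT.bdry f h0).elim hfe hf.not_bdry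
  refine ⟨T.filter fun r => T₂ r ≠ 0, ⟨hmem, ?_, fun u hu => ?_⟩, ?_⟩
  · obtain ⟨r, r', hrr, hr, hr', hfr, hfr'⟩ := h.exists_pair hf.face hf.card hf.not_bdry
    have hT₂f := hT₂.ne
    rw [bd_apply_of_pair hK hT₂.mem hf3 hrr hr hr' hfr hfr'] at hT₂f
    rw [bd_apply_of_pair hK hT.mem hf3 hrr hr hr' hfr hfr'] at hTf
    have hTr := add_eq _ _ hTf
    have hTr1 : T r = 1 := by
      have htK := mem_chains.1 hT.mem t ht
      rcases hK f t r r' hf3 htK hr hr' hft hfr hfr' with e | e | e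
      · exact zmod_two_eq_one (e ▸ ht)
      · rw [hTr]; exact zmod_two_eq_one (e ▸ ht)
      · exact absurd e hrr
    rw [bd_apply_of_pair hK hmem hf3 hrr hr hr' hfr hfr', hval, hval, ← hTr, hTr1, one_mul, one_mul]
    exact hT₂f
  · by_cases hub : BdryFace 3 K u
    · exact Or.inr hub
    · left
      by_contra huf
      have hu' := mem_chains.1 (bd_mem_chains (k := 2) hmem) u hu
      obtain ⟨r, r', hrr, hr, hr', hur, hur'⟩ := h.exists_pair hu'.1 hu'.2 hub
      have hu3 : u.card + 1 = 3 := by omega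
      have h2 : bd T₂ u = 0 := by
        by_contra h0
        exact (hT₂.bdry u h0).elim huf hub
      rw [bd_apply_of_pair hK hT₂.mem hu3 hrr hr hr' hur hur'] at h2
      have h2' := add_eq _ _ h2
      rw [bd_apply_of_pair hK hmem hu3 hrr hr hr' hur hur', hval, hval, ← h2', ← add_mul] at hu
      by_cases hue : u = e
      · subst hue
        have : T₂ r = 0 := by
          rcases hK u s r r' hu3 hs hr hr' hes hur hur' with e | e | e
          · exact e ▸ hT2s
          · rw [h2']; exact e ▸ hT2s
          · exact absurd e hrr
        rw [this, mul_zero] at hu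
        exact hu rfl
      · have h1 : bd T u = 0 := by
          by_contra h0
          exact (hT.bdry u h0).elim hue hub
        rw [bd_apply_of_pair hK hT.mem hu3 hrr hr hr' hur hur'] at h1
        rw [h1, zero_mul] at hu
        exact hu rfl
  · refine Finset.card_lt_card (Finset.ssubset_iff_of_subset ?_ |>.2 ⟨s, ?_, ?_⟩)
    · intro r hr
      rw [Finsupp.mem_support_iff, hval] at hr
      exact Finsupp.mem_support_iff.2 (left_ne_zero_of_mul hr)
    · exact Finsupp.mem_support_iff.2 hTs
    · rw [Finsupp.mem_support_iff, hval, hT2s, mul_zero]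
      exact fun h => h rfl

/-- Among the chords in a nonempty family there is one that cuts off a set of triangles without
further chords in the family. -/
theorem ConstructibleAux.exists_innermost_chord (h : ConstructibleAux 3 K)
    (hK : IsPseudomanifold 3 K) (P : Finset V → Prop) (hP : ∀ e, P e → IsChord K e)
    (hne : ∃ e, P e) : ∃ e T, P e ∧ CutsOff K e T ∧
      ∀ f t, P f → T t ≠ 0 → f ⊆ t → f = e := by
  obtain ⟨e, he⟩ := hne
  obtain ⟨T, hT⟩ := (hP e he).exists_cutsOff h hK
  induction hn : T.support.card using Nat.strong_induction_on generalizing e T with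
  | _ n ih =>
    by_cases hmin : ∀ f t, P f → T t ≠ 0 → f ⊆ t → f = e
    · exact ⟨e, T, he, hT, hmin⟩
    · push Not at hmin
      obtain ⟨f, t, hf, ht, hft, hfe⟩ := hmin
      obtain ⟨T₂, hT₂⟩ := (hP f hf).exists_cutsOff h hK
      obtain ⟨T₃, hT₃, hlt⟩ := hT.exists_smaller h hK hT₂ (hP e he) (hP f hf) hfe ht hft
      exact ih _ (hn ▸ hlt) f hf T₃ hT₃ rfl

end Disk

/-! ### Interior components and reducedness -/

section Interior

variable {V : Type*} {B : PreAbstractSimplicialComplex V}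

theorem mem_boundary_iff {C : PreAbstractSimplicialComplex V} {s : Finset V} :
    s ∈ boundary C ↔ s.Nonempty ∧ ∃ t, BdryFace 4 C t ∧ s ⊆ t := by
  change (s.Nonempty ∧ ∃ t ∈ C, t.card = 3 ∧ s ⊆ t ∧
    ∃! u : Finset V, u ∈ C ∧ u.card = 4 ∧ t ⊆ u) ↔ _
  have key : ∀ t u : Finset V, (u ∈ C ∧ u.card = 4 ∧ t ⊆ u) ↔
      ((Face C u ∧ u.card = 4) ∧ t ⊆ u) := by
    intro t u
    constructor
    · rintro ⟨h1, h2, h3⟩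
      exact ⟨⟨Or.inl h1, h2⟩, h3⟩
    · rintro ⟨⟨h1, h2⟩, h3⟩
      exact ⟨h1.mem_of_card h2, h2, h3⟩
  simp only [key]
  refine and_congr_right fun _ => exists_congr fun t => ?_
  constructor
  · rintro ⟨-, h2, h3, h4⟩
    exact ⟨⟨by omega, h4⟩, h3⟩
  · rintro ⟨h, h3⟩
    have h3' : t.card = 3 := by have := h.1; omega
    exact ⟨h.face.mem_of_card h3', h3', h3, h.2⟩

/-- The vertices of a maximal interior graph component. -/
def componentSet (I : MaxInteriorComponent B) : Set V := Subtype.val '' I.supp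

theorem mem_componentSet {I : MaxInteriorComponent B} {x : V} :
    x ∈ componentSet I ↔ ∃ h : x ∈ interiorVertices B,
      (edgeGraph B (interiorVertices B)).connectedComponentMk ⟨x, h⟩ = I := by
  constructor
  · rintro ⟨⟨x, hx⟩, h, rfl⟩
    exact ⟨hx, h⟩
  · rintro ⟨hx, h⟩
    exact ⟨⟨x, hx⟩, h, rfl⟩

theorem exists_mem_componentSet {x : V} (hx : x ∈ interiorVertices B) :
    ∃ I : MaxInteriorComponent B, x ∈ componentSet I :=
  ⟨_, mem_componentSet.2 ⟨hx, rfl⟩⟩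

theorem componentSet_unique {I J : MaxInteriorComponent B} {x : V} (hI : x ∈ componentSet I)
    (hJ : x ∈ componentSet J) : I = J := by
  obtain ⟨h, rfl⟩ := mem_componentSet.1 hI
  obtain ⟨h', rfl⟩ := mem_componentSet.1 hJ
  rfl

theorem mem_componentSet_of_mem {I : MaxInteriorComponent B} {x y : V} {s : Finset V} (hs : s ∈ B)
    (hx : x ∈ s) (hy : y ∈ s) (hyI : y ∈ interiorVertices B) (hxI : x ∈ componentSet I) :
    y ∈ componentSet I := by
  obtain ⟨h, rfl⟩ := mem_componentSet.1 hxI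
  refine mem_componentSet.2 ⟨hyI, ?_⟩
  by_cases hxy : x = y
  · subst hxy; rfl
  · rw [SimpleGraph.ConnectedComponent.eq]
    refine SimpleGraph.Adj.reachable ⟨fun h' => hxy (congrArg Subtype.val h').symm, s, hs, hy, hx⟩

/-- Two vertices are in the same connected component of `∂B ∩ Star_B I`. -/
def BoundaryRel (I : MaxInteriorComponent B) : V → V → Prop :=
  Relation.EqvGen fun p q => ∃ s ∈ boundary B ⊓ closedStar B (componentSet I), p ∈ s ∧ q ∈ s

/-- The equivalence closure is also reflexive at points outside the complex, hence the requirement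
`p ≠ q`. -/
theorem BoundaryRel.exists_component {I : MaxInteriorComponent B} {p q : V}
    (h : BoundaryRel I p q) (hpq : p ≠ q) :
    ∃ C : Component (boundary B ⊓ closedStar B (componentSet I)),
      p ∈ Subtype.val '' C.supp ∧ q ∈ Subtype.val '' C.supp := by
  set L := boundary B ⊓ closedStar B (componentSet I) with hL
  have key : p = q ∨ ∃ (hp : p ∈ vertexSet L) (hq : q ∈ vertexSet L),
      (edgeGraph L (vertexSet L)).Reachable ⟨p, hp⟩ ⟨q, hq⟩ := by
    clear hpq
    induction h with
    | rel p q h =>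
      obtain ⟨s, hs, hp, hq⟩ := h
      by_cases hpq : p = q
      · exact Or.inl hpq
      · refine Or.inr ⟨mem_of_subset hs (by simpa using hp) (by simp),
          mem_of_subset hs (by simpa using hq) (by simp), ?_⟩
        exact SimpleGraph.Adj.reachable ⟨fun h => hpq (congrArg Subtype.val h), s, hs, hp, hq⟩
    | refl p => exact Or.inl rfl
    | symm p q _ ih =>
      rcases ih with rfl | ⟨hp, hq, h⟩
      · exact Or.inl rfl
      · exact Or.inr ⟨hq, hp, h.symm⟩
    | trans p q r _ _ ih₁ ih₂ =>
      rcases ih₁ with rfl | ⟨hp, hq, h⟩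
      · exact ih₂
      · rcases ih₂ with rfl | ⟨hq', hr, h'⟩
        · exact Or.inr ⟨hp, hq, h⟩
        · exact Or.inr ⟨hp, hr, h.trans h'⟩
  obtain ⟨hp, hq, hr⟩ := key.resolve_left hpq
  exact ⟨(edgeGraph L (vertexSet L)).connectedComponentMk ⟨p, hp⟩, ⟨⟨p, hp⟩, rfl, rfl⟩,
    ⟨⟨q, hq⟩, (SimpleGraph.ConnectedComponent.eq.2 hr.symm), rfl⟩⟩

theorem exists_mem_interiorVertices {u : Finset V} (hu : u ∈ B) (hu2 : u.card = 2)
    (hub : u ∉ boundary B) (hus : ¬ IsSpanningEdge B u) : ∃ x ∈ u, x ∈ interiorVertices B := by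
  by_contra! h
  refine hus ⟨hu, hu2, hub, fun v hv => ?_⟩
  by_contra hvb
  exact h v hv ⟨mem_of_subset hu (by simpa using hv) (by simp), hvb⟩

/-- With all vertices on the boundary, each of the three edges would be spanning or in `∂B`. At most
one is spanning by `he`, and at most one lies in `∂B` by reducedness. -/
theorem IsReduced.exists_mem_interiorVertices (hred : IsReduced B) {t e : Finset V} (ht : t ∈ B)
    (ht3 : t.card = 3) (htb : t ∉ boundary B)
    (he : ∀ f, IsSpanningEdge B f → f ⊆ t → f = e) : ∃ x ∈ t, x ∈ interiorVertices B := by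
  classical
  by_contra! h
  have hsub := hred t ht ht3 htb
  obtain ⟨a, b, c, hab, hac, hbc, rfl⟩ := Finset.card_eq_three.1 ht3
  have key : ∀ x y z : V, x ≠ y → x ≠ z → y ≠ z → ({x, y} : Finset V) ≠ {x, z} := by
    intro x y z _ _ hyz h
    have : y ∈ ({x, z} : Finset V) := h ▸ by simp
    simp only [Finset.mem_insert, Finset.mem_singleton] at this
    tauto
  have edge : ∀ x y : V, x ≠ y → {x, y} ⊆ ({a, b, c} : Finset V) →
      ({x, y} : Finset V) = e ∨ ({x, y} : Finset V) ∈
        {e : Finset V | e ⊆ {a, b, c} ∧ e.card = 2 ∧ e ∈ boundary B} := by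
    intro x y hxy hs
    by_cases hb : ({x, y} : Finset V) ∈ boundary B
    · exact Or.inr ⟨hs, Finset.card_pair hxy, hb⟩
    · left
      refine he _ ?_ hs
      by_contra hspan
      obtain ⟨v, hv, hvi⟩ := SimplicialBall.exists_mem_interiorVertices
        (mem_of_subset ht hs (by simp)) (Finset.card_pair hxy) hb hspan
      exact h v (hs hv) hvi
  have n1 : ({a, b} : Finset V) ≠ {a, c} := key a b c hab hac hbc
  have n2 : ({a, b} : Finset V) ≠ {b, c} := by
    rw [Finset.pair_comm a b]; exact key b a c hab.symm hbc hac
  have n3 : ({a, c} : Finset V) ≠ {b, c} := by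
    rw [Finset.pair_comm a c, Finset.pair_comm b c]; exact key c a b hac.symm hbc.symm hab
  have e1 := edge a b hab (by intro x; simp; tauto)
  have e2 := edge a c hac (by intro x; simp; tauto)
  have e3 := edge b c hbc (by intro x; simp; tauto)
  rcases e1 with e1 | e1 <;> rcases e2 with e2 | e2 <;> rcases e3 with e3 | e3
  · exact n1 (e1.trans e2.symm)
  · exact n1 (e1.trans e2.symm)
  · exact n2 (e1.trans e3.symm)
  · exact n3 (hsub e2 e3)
  · exact n3 (e2.trans e3.symm)
  · exact n2 (hsub e1 e3)
  · exact n1 (hsub e1 e2)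
  · exact n1 (hsub e1 e2)

end Interior

/-! ### Pieces of the decomposition and the main induction -/

section Pieces

variable {V : Type*} {B : PreAbstractSimplicialComplex V}

/-- The properties inherited by the pieces of a decomposition of `B`. The labels `μ` record to which
component of `∂B ∩ Star_B I` an interior vertex in the boundary of the piece belongs. -/
structure IsPiece (B C : PreAbstractSimplicialComplex V) : Prop where
  le : C ≤ B
  mem_boundary : ∀ s ∈ C, s ∈ boundary B → s ∈ boundary C
  not_spanning : ∀ e ∈ boundary C, ¬ IsSpanningEdge B e
  label : ∃ μ : V → V, (∀ v ∈ vertexSet (boundary B), μ v = v) ∧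
    ∀ (I : MaxInteriorComponent B) (s : Finset V) (x y : V), s ∈ boundary C → x ∈ s → y ∈ s →
      x ∈ componentSet I → BoundaryRel I (μ x) (μ y)

/-- `∂B` has no interior vertices, so the label condition is vacuous. -/
theorem isPiece_self (B : PreAbstractSimplicialComplex V) : IsPiece B B where
  le := le_rfl
  mem_boundary := fun _ _ h => h
  not_spanning := fun _ h h' => h'.2.2.1 h
  label := by
    refine ⟨id, fun _ _ => rfl, fun I s x y hs hx _ hxI => ?_⟩
    obtain ⟨h, -⟩ := mem_componentSet.1 hxI
    exact absurd (mem_of_subset hs (by simpa using hx) (by simp)) h.2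

/-- An interior end of `g` lies in `I`, since `t` meets `I`, and the label condition applies. With
no interior end the labels are the ends themselves; as `g` is not spanning, it lies in `∂B` and in
the star of `I`. -/
theorem boundaryRel_label {C : PreAbstractSimplicialComplex V} (hC : IsPiece B C) {μ : V → V}
    (hμ : ∀ v ∈ vertexSet (boundary B), μ v = v)
    (hμC : ∀ (I : MaxInteriorComponent B) (s : Finset V) (x y : V), s ∈ boundary C → x ∈ s → y ∈ s →
      x ∈ componentSet I → BoundaryRel I (μ x) (μ y)) {I : MaxInteriorComponent B}
    {g t : Finset V} (hg : g ∈ boundary C) (hg2 : g.card = 2) (ht : t ∈ B) (hgt : g ⊆ t) {x : V}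
    (hxt : x ∈ t) (hxI : x ∈ componentSet I) {a b : V} (ha : a ∈ g) (hb : b ∈ g) :
    BoundaryRel I (μ a) (μ b) := by
  have hgB : g ∈ B := mem_of_subset ht hgt (nonempty_of_mem hg)
  have hvert : ∀ v ∈ g, v ∉ interiorVertices B → v ∈ vertexSet (boundary B) := by
    intro v hv hvi
    by_contra h
    exact hvi ⟨mem_of_subset hgB (by simpa using hv) (by simp), h⟩
  have hcomp : ∀ v ∈ g, v ∈ interiorVertices B → v ∈ componentSet I := fun v hv hvi =>
    mem_componentSet_of_mem ht hxt (hgt hv) hvi hxI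
  by_cases hai : a ∈ interiorVertices B
  · exact hμC I g a b hg ha hb (hcomp a ha hai)
  by_cases hbi : b ∈ interiorVertices B
  · exact (hμC I g b a hg hb ha (hcomp b hb hbi)).symm
  · rw [hμ a (hvert a ha hai), hμ b (hvert b hb hbi)]
    by_cases hab : a = b
    · rw [hab]; exact Relation.EqvGen.refl _
    refine Relation.EqvGen.rel _ _ ⟨g, ⟨?_, nonempty_of_mem hg, t, ht, hgt, x, hxt, hxI⟩, ha, hb⟩
    by_contra hgb
    obtain ⟨v, hv, hvi⟩ := exists_mem_interiorVertices hgB hg2 hgb (hC.not_spanning g hg)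
    classical
    have hgab : {a, b} = g := Finset.eq_of_subset_of_card_le
      (Finset.insert_subset ha (by simpa using hb)) (by rw [Finset.card_pair hab]; omega)
    rw [← hgab, Finset.mem_insert, Finset.mem_singleton] at hv
    rcases hv with rfl | rfl
    · exact hai hvi
    · exact hbi hvi

variable {C₁ C₂ : PreAbstractSimplicialComplex V}

theorem IsSplit.mem_boundary_left (hs : IsSplit 3 C₁ C₂) {s : Finset V} (h₁ : s ∈ C₁)
    (h : s ∈ boundary (C₁ ⊔ C₂)) : s ∈ boundary C₁ := by
  obtain ⟨hne, t, ht, hst⟩ := mem_boundary_iff.1 h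
  refine mem_boundary_iff.2 ⟨hne, ?_⟩
  by_cases h₂ : s ∈ C₂
  · obtain ⟨u, hu, hu3, hsu⟩ := hs.inter.exists_facet (face_inf.2 ⟨Or.inl h₁, Or.inl h₂⟩)
    exact ⟨u, hs.bdryFace_left hu hu3, hsu⟩
  · refine ⟨t, hs.bdryFace_of_union ht ?_, hst⟩
    exact (face_sup.1 ht.face).resolve_right fun h => h₂ ((h.subset hst).mem hne)

theorem boundary_left_subset {s : Finset V} (h : s ∈ boundary C₁) :
    s ∈ boundary (C₁ ⊔ C₂) ∨ s ∈ C₁ ⊓ C₂ := by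
  obtain ⟨hne, t, ht, hst⟩ := mem_boundary_iff.1 h
  rcases IsSplit.bdryFace_union_or (K₂ := C₂) ht with h' | h'
  · exact Or.inl (mem_boundary_iff.2 ⟨hne, t, h', hst⟩)
  · exact Or.inr (((face_inf.2 ⟨ht.face, h'⟩).subset hst).mem hne)

theorem IsSplit.not_mem_boundary_of_triangle (hs : IsSplit 3 C₁ C₂) (hC : IsPiece B (C₁ ⊔ C₂))
    {t : Finset V} (ht : t ∈ C₁ ⊓ C₂) (ht3 : t.card = 3) : t ∉ boundary B := by
  intro hb
  obtain ⟨-, u, hu, htu⟩ := mem_boundary_iff.1 (hC.mem_boundary t (Or.inl ht.1) hb)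
  rw [← Finset.eq_of_subset_of_card_le htu (by have := hu.1; omega)] at hu
  exact hs.not_bdryFace (Or.inl ht) hu

variable [DecidableEq V]

theorem IsSplit.mem_boundary_iff_of_inter (hs : IsSplit 3 C₁ C₂) {g : Finset V} (hg : g ∈ C₁ ⊓ C₂) :
    g ∈ boundary (C₁ ⊔ C₂) ↔ ∃ u, BdryFace 3 (C₁ ⊓ C₂) u ∧ g ⊆ u := by
  rw [hs.inter_bdry_iff (Or.inl hg), mem_boundary_iff]
  exact and_iff_right (nonempty_of_mem hg)

theorem IsSplit.mem_boundary_iff_of_edge (hs : IsSplit 3 C₁ C₂) {g : Finset V} (hg : g ∈ C₁ ⊓ C₂)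
    (hg2 : g.card = 2) : g ∈ boundary (C₁ ⊔ C₂) ↔ BdryFace 3 (C₁ ⊓ C₂) g := by
  rw [hs.mem_boundary_iff_of_inter hg]
  constructor
  · rintro ⟨u, hu, hgu⟩
    rwa [Finset.eq_of_subset_of_card_le hgu (by have := hu.1; omega)]
  · exact fun h => ⟨g, h, subset_rfl⟩

theorem IsSplit.not_mem_boundary_of_edge (hs : IsSplit 3 C₁ C₂) (hC : IsPiece B (C₁ ⊔ C₂))
    {g : Finset V} (hg : g ∈ C₁ ⊓ C₂) (hg2 : g.card = 2) (hgb : ¬ BdryFace 3 (C₁ ⊓ C₂) g) :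
    g ∉ boundary B := fun h =>
  hgb ((hs.mem_boundary_iff_of_edge hg hg2).1 (hC.mem_boundary g (Or.inl hg.1) h))

/-- The dividing surface contains no spanning edge. -/
theorem IsSplit.not_spanning_inter (hs : IsSplit 3 C₁ C₂) (hC : IsPiece B (C₁ ⊔ C₂))
    (hred : IsReduced B) (hstrict : ∀ e, IsSpanningEdge B e → IsStrict B e) {e : Finset V}
    (he : e ∈ C₁ ⊓ C₂) : ¬ IsSpanningEdge B e := by
  classical
  intro hspan
  set D := C₁ ⊓ C₂ with hD
  have hDB : ∀ s ∈ D, s ∈ B := fun s h => hC.le (Or.inl h.1)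
  have hDpm : IsPseudomanifold 3 D := hs.pm_inter
  -- A spanning edge on the boundary of `D` would lie on the boundary of the piece, which is
  -- excluded.
  have hchord : ∀ e, IsSpanningEdge B e ∧ e ∈ D → IsChord D e := by
    rintro e ⟨he, heD⟩
    refine ⟨Or.inl heD, he.2.1, fun h => ?_, fun v hv => ?_⟩
    · exact hC.not_spanning e ((hs.mem_boundary_iff_of_edge heD he.2.1).2 h) he
    · have hvD : {v} ∈ D := mem_of_subset heD (by simpa using hv) (by simp)
      obtain ⟨u, hu, hvu⟩ := (hs.mem_boundary_iff_of_inter hvD).1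
        (hC.mem_boundary _ (Or.inl hvD.1) (he.2.2.2 v hv))
      exact ⟨u, hu, by simpa using hvu⟩
  obtain ⟨e, T, ⟨hespan, heD⟩, hT, hmin⟩ := hs.inter.exists_innermost_chord hDpm
    (fun e => IsSpanningEdge B e ∧ e ∈ D) hchord ⟨e, hspan, he⟩
  clear hspan he
  have hechord := hchord e ⟨hespan, heD⟩
  obtain ⟨s, s', hss, hsD, hsD', hes, hes'⟩ :=
    hs.inter.exists_pair hechord.face hechord.card hechord.not_bdry
  have he3 : e.card + 1 = 3 := by have := hechord.card; omega
  have hTe := hT.ne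
  rw [bd_apply_of_pair hDpm hT.mem he3 hss hsD hsD' hes hes'] at hTe
  wlog hTs : T s ≠ 0 generalizing s s'
  · rw [not_not] at hTs
    refine this s' s hss.symm hsD' hsD hes' hes (by rwa [add_comm]) ?_
    rwa [hTs, zero_add] at hTe
  have hTs' : T s' = 0 := by
    by_contra h
    rw [zmod_two_eq_one hTs, zmod_two_eq_one h] at hTe
    exact hTe (ZModModule.add_self _)
  have hsm := hsD.1.mem_of_card hsD.2
  -- By minimality `e` is the only possible spanning edge of this triangle.
  obtain ⟨x, hxs, hxi⟩ := hred.exists_mem_interiorVertices (hDB s hsm) hsD.2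
    (hs.not_mem_boundary_of_triangle hC hsm hsD.2) (e := e)
    (fun f hf hfs => hmin f s ⟨hf, mem_of_subset hsm hfs (nonempty_of_mem hf.1)⟩ hTs hfs)
  obtain ⟨I, hxI⟩ := exists_mem_componentSet hxi
  set TI := T.filter fun t => ∃ y ∈ t, y ∈ componentSet I with hTI
  have hval : ∀ r, TI r = if ∃ y ∈ r, y ∈ componentSet I then T r else 0 := fun r => by
    rw [hTI, Finsupp.filter_apply]
  have hTImem : TI ∈ chains D 3 := by
    refine mem_chains.2 fun r hr => mem_chains.1 hT.mem r fun h0 => hr ?_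
    rw [hval, h0, ite_self]
  have hze : bd TI e ≠ 0 := by
    rw [bd_apply_of_pair hDpm hTImem he3 hss hsD hsD' hes hes', hval, hval,
      if_pos ⟨x, hxs, hxI⟩, hTs', ite_self, add_zero]
    exact hTs
  have hbdry : ∀ u, bd TI u ≠ 0 → u ≠ e → BdryFace 3 D u := by
    intro u hu hue
    by_contra hub
    have hu' := mem_chains.1 (bd_mem_chains (k := 2) hTImem) u hu
    have huD := hu'.1.mem_of_card hu'.2
    obtain ⟨r, r', hrr, hr, hr', hur, hur'⟩ := hs.inter.exists_pair hu'.1 hu'.2 hub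
    have hu3 : u.card + 1 = 3 := by omega
    have h0 : bd T u = 0 := by
      by_contra h0
      exact (hT.bdry u h0).elim hue hub
    rw [bd_apply_of_pair hDpm hT.mem hu3 hrr hr hr' hur hur'] at h0
    have add_eq : ∀ a b : ZMod 2, a + b = 0 → a = b := by decide
    have hTr := add_eq _ _ h0
    rw [bd_apply_of_pair hDpm hTImem hu3 hrr hr hr' hur hur', hval, hval, ← hTr] at hu
    by_cases hT0 : T r = 0
    · rw [hT0] at hu
      simp at hu
    obtain ⟨y, hyu, hyi⟩ := exists_mem_interiorVertices (hDB u huD) hu'.2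
      (hs.not_mem_boundary_of_edge hC huD hu'.2 hub)
      (fun h => hue (hmin u r ⟨h, huD⟩ hT0 hur))
    -- A triangle containing the interior vertex `y` meets `I` exactly when `y ∈ I`, so the two
    -- triangles at `u` cancel.
    have hiff : ∀ r : Finset V, Face D r ∧ r.card = 3 → u ⊆ r →
        ((∃ y ∈ r, y ∈ componentSet I) ↔ y ∈ componentSet I) := by
      intro r hr hur
      constructor
      · rintro ⟨w, hwr, hwI⟩
        exact mem_componentSet_of_mem (hDB r (hr.1.mem_of_card hr.2)) hwr (hur hyu) hyi hwI
      · exact fun h => ⟨y, hur hyu, h⟩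
    simp only [hiff r hr hur, hiff r' hr' hur'] at hu
    exact hu (ZModModule.add_self _)
  obtain ⟨μ, hμ, hμC⟩ := hC.label
  obtain ⟨v, w, hvw, rfl⟩ := Finset.card_eq_two.1 hechord.card
  have hμv := hμ v (hespan.2.2.2 v (by simp))
  have hμw := hμ w (hespan.2.2.2 w (by simp))
  have hrel : w ∈ {u | BoundaryRel I v (μ u)} := by
    -- Every edge of the cycle `bd TI` except `e` preserves being related to `v`; by parity `e`
    -- cannot be the only edge leaving that set.
    refine mem_of_bd_eq_zero (bd_bd TI)
      (fun g hg => (mem_chains.1 (bd_mem_chains (k := 2) hTImem) g hg).2) _ hvw hze ?_ ?_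
    · intro g hg hge a ha b hb haS
      have hg2 := (mem_chains.1 (bd_mem_chains (k := 2) hTImem) g hg).2
      have hgb := hbdry g hg hge
      have hgC := (hs.mem_boundary_iff_of_edge (hgb.face.mem_of_card hg2) hg2).2 hgb
      rw [bd_apply] at hg
      obtain ⟨t, ht, htg⟩ := Finset.exists_ne_zero_of_sum_ne_zero hg
      rw [Finsupp.mem_support_iff] at ht
      have htD := mem_chains.1 hTImem t ht
      have hgt : g ⊆ t := by
        by_contra hn
        exact htg (if_neg fun h => hn h.1)
      rw [hval] at ht
      obtain ⟨y, hyt, hyI⟩ : ∃ y ∈ t, y ∈ componentSet I := by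
        by_contra hn
        exact ht (if_neg hn)
      exact Relation.EqvGen.trans _ _ _ haS (boundaryRel_label hC hμ hμC hgC hg2
        (hDB t (htD.1.mem_of_card htD.2)) hgt hyt hyI ha hb)
    · change BoundaryRel I v (μ v)
      rw [hμv]
      exact Relation.EqvGen.refl _
  change BoundaryRel I v (μ w) at hrel
  rw [hμw] at hrel
  obtain ⟨Q, hvQ, hwQ⟩ := hrel.exists_component hvw
  refine hstrict _ hespan ⟨I, Q, fun u hu => ?_⟩
  rw [Finset.mem_insert, Finset.mem_singleton] at hu
  rcases hu with rfl | rfl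
  · exact hvQ
  · exact hwQ

/-- If the dividing surface contains no spanning edge, then all its triangles meet one and the same
maximal interior graph component. -/
theorem IsSplit.exists_component (hs : IsSplit 3 C₁ C₂) (hC : IsPiece B (C₁ ⊔ C₂))
    (hred : IsReduced B) (hD : ∀ e ∈ C₁ ⊓ C₂, ¬ IsSpanningEdge B e) :
    ∃ I : MaxInteriorComponent B, ∀ t ∈ C₁ ⊓ C₂, t.card = 3 → ∃ y ∈ t, y ∈ componentSet I := by
  have hDB : ∀ s ∈ C₁ ⊓ C₂, s ∈ B := fun s h => hC.le (Or.inl h.1)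
  obtain ⟨t₀, ht₀, ht₀3, -⟩ := hs.inter.exists_facet (face_empty _)
  have htm := ht₀.mem_of_card ht₀3
  obtain ⟨x, hxt, hxi⟩ := hred.exists_mem_interiorVertices (hDB t₀ htm) ht₀3
    (hs.not_mem_boundary_of_triangle hC htm ht₀3) (e := ∅)
    (fun f hf hft => absurd hf (hD f (mem_of_subset htm hft (nonempty_of_mem hf.1))))
  obtain ⟨I, hxI⟩ := exists_mem_componentSet hxi
  refine ⟨I, fun t ht ht3 => ?_⟩
  refine hs.inter.mem_of_adjacent {t | ∃ y ∈ t, y ∈ componentSet I} ?_ ht₀ ht₀3 ⟨x, hxt, hxI⟩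
    (Or.inl ht) ht3
  rintro a b u ha hb ha3 hb3 hu hua hub ⟨y, hya, hyI⟩
  by_cases hab : a = b
  · exact hab ▸ ⟨y, hya, hyI⟩
  have hu2 : u.card = 2 := by omega
  have huD := (ha.subset hua).mem_of_card hu2
  -- The shared edge is interior to `D` and not spanning, so it carries an interior vertex that
  -- passes the component on.
  obtain ⟨z, hzu, hzi⟩ := exists_mem_interiorVertices (hDB u huD) hu2
    (hs.not_mem_boundary_of_edge hC huD hu2 fun h => hab
      (h.2.unique ⟨⟨ha, ha3⟩, hua⟩ ⟨⟨hb, hb3⟩, hub⟩)) (hD u huD)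
  exact ⟨z, hub hzu,
    mem_componentSet_of_mem (hDB a (ha.mem_of_card ha3)) hya (hua hzu) hzi hyI⟩

/-- Only the vertices of `D` off the boundary of the old piece need new labels. All receive `μ d`
for one `d` on the boundary of `D`, or an arbitrary `d` if `D` is closed. -/
theorem IsSplit.isPiece_left (hs : IsSplit 3 C₁ C₂) (hC : IsPiece B (C₁ ⊔ C₂))
    (hred : IsReduced B) (hstrict : ∀ e, IsSpanningEdge B e → IsStrict B e) : IsPiece B C₁ where
  le := le_sup_left.trans hC.le
  mem_boundary := fun s hs₁ hsb => hs.mem_boundary_left hs₁ (hC.mem_boundary s (Or.inl hs₁) hsb)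
  not_spanning := fun e he => (boundary_left_subset he).elim (hC.not_spanning e)
    (hs.not_spanning_inter hC hred hstrict)
  label := by
    classical
    have hDB : ∀ s ∈ C₁ ⊓ C₂, s ∈ B := fun s h => hC.le (Or.inl h.1)
    obtain ⟨μ, hμ, hμC⟩ := hC.label
    obtain ⟨I₀, hI₀⟩ := hs.exists_component hC hred
      (fun e he => hs.not_spanning_inter hC hred hstrict he)
    have hpure : ∀ s ∈ C₁ ⊓ C₂, ∃ t ∈ B, s ⊆ t ∧ ∃ y ∈ t, y ∈ componentSet I₀ := by
      intro s hsD
      obtain ⟨t, ht, ht3, hst⟩ := hs.inter.exists_facet (Or.inl hsD)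
      have htm := ht.mem_of_card ht3
      exact ⟨t, hDB t htm, hst, hI₀ t htm ht3⟩
    obtain ⟨d, hd⟩ : ∃ d, ∀ x g, BdryFace 3 (C₁ ⊓ C₂) g → x ∈ g →
        BoundaryRel I₀ (μ d) (μ x) := by
      by_cases hex : ∃ g a, BdryFace 3 (C₁ ⊓ C₂) g ∧ a ∈ g
      · obtain ⟨g, d, hg, hdg⟩ := hex
        refine ⟨d, fun x g' hg' hxg' => ?_⟩
        refine hs.inter.bdry_connected hs.pm_inter {x | BoundaryRel I₀ (μ d) (μ x)} ?_ hg hdg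
          (Relation.EqvGen.refl _) hg' hxg'
        intro r hr a ha b hb haS
        have hr2 : r.card = 2 := by have := hr.1; omega
        have hrD := hr.face.mem_of_card hr2
        obtain ⟨t, ht, hrt, y, hyt, hyI⟩ := hpure r hrD
        exact Relation.EqvGen.trans _ _ _ haS (boundaryRel_label hC hμ hμC
          ((hs.mem_boundary_iff_of_edge hrD hr2).2 hr) hr2 ht hrt hyt hyI ha hb)
      · obtain ⟨t, ht, ht3, -⟩ := hs.inter.exists_facet (face_empty _)
        obtain ⟨d, -⟩ := Finset.card_pos.1 (by omega : 0 < t.card)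
        exact ⟨d, fun x g hg hx => absurd ⟨g, x, hg, hx⟩ hex⟩
    set μ' : V → V := fun x =>
      if {x} ∈ C₁ ⊓ C₂ ∧ {x} ∉ boundary (C₁ ⊔ C₂) then μ d else μ x with hμ'
    have hμ'D : ∀ x, {x} ∈ C₁ ⊓ C₂ → BoundaryRel I₀ (μ d) (μ' x) := by
      intro x hx
      by_cases hxb : {x} ∈ boundary (C₁ ⊔ C₂)
      · obtain ⟨g, hg, hxg⟩ := (hs.mem_boundary_iff_of_inter hx).1 hxb
        simp only [hμ', hxb, not_true_eq_false, and_false, if_false]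
        exact hd x g hg (by simpa using hxg)
      · simp only [hμ', hx, hxb, not_false_eq_true, and_self, if_true]
        exact Relation.EqvGen.refl _
    refine ⟨μ', fun v hv => ?_, fun I s x y hsb hx hy hxI => ?_⟩
    · have : ¬ ({v} ∈ C₁ ⊓ C₂ ∧ {v} ∉ boundary (C₁ ⊔ C₂)) := fun h =>
        h.2 (hC.mem_boundary _ (Or.inl h.1.1) hv)
      simp only [hμ', this, if_false]
      exact hμ v hv
    · rcases boundary_left_subset (C₂ := C₂) hsb with h | h
      · have hout : ∀ z ∈ s, μ' z = μ z := by
          intro z hz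
          have : {z} ∈ boundary (C₁ ⊔ C₂) := mem_of_subset h (by simpa using hz) (by simp)
          simp only [hμ', this, not_true_eq_false, and_false, if_false]
        rw [hout x hx, hout y hy]
        exact hμC I s x y h hx hy hxI
      · obtain ⟨t, ht, hst, z, hzt, hzI⟩ := hpure s h
        obtain ⟨hxi, -⟩ := mem_componentSet.1 hxI
        -- A face of `D` lies in a triangle meeting `I₀`, so its interior vertices belong to `I₀`.
        obtain rfl := componentSet_unique hxI (mem_componentSet_of_mem ht hzt (hst hx) hxi hzI)
        exact Relation.EqvGen.trans _ _ _
          (hμ'D x (mem_of_subset h (by simpa using hx) (by simp))).symm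
          (hμ'D y (mem_of_subset h (by simpa using hy) (by simp)))

theorem IsPiece.not_mem_of_spanning (hB : IsPseudomanifold 4 B) (hred : IsReduced B)
    (hstrict : ∀ e, IsSpanningEdge B e → IsStrict B e) {C : PreAbstractSimplicialComplex V}
    (hcons : ConstructibleAux 4 C) (hC : IsPiece B C) {e : Finset V} (he : IsSpanningEdge B e) :
    e ∉ C := by
  generalize hn : 4 = n at hcons
  induction hcons with
  | simplex s =>
    intro hes
    have hs : e ⊆ s := hes.2
    -- Any triangle of the single tetrahedron containing `e` is a boundary face.
    obtain ⟨t, het, hts, ht3⟩ := Finset.exists_subsuperset_card_eq hs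
      (n := 3) (by have := he.2.1; omega) (by omega)
    refine hC.not_spanning e (mem_boundary_iff.2 ⟨nonempty_of_mem he.1, t, ⟨by omega, s,
      ⟨⟨face_simplex.2 subset_rfl, hn.symm⟩, hts⟩, ?_⟩, het⟩) he
    rintro r ⟨⟨hr, hr4⟩, -⟩
    exact Finset.eq_of_subset_of_card_le (face_simplex.1 hr) (by omega)
  | @union n K₁ K₂ h₁ h₂ h ih₁ ih₂ _ =>
    obtain rfl : n = 3 := by omega
    have hs : IsSplit 3 K₁ K₂ :=
      ⟨h₁, h₂, h, hB.mono fun s hs => hs.imp (fun h => hC.le h) id⟩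
    rintro (he | he)
    · exact ih₁ (hs.isPiece_left hC hred hstrict) rfl he
    · exact ih₂ (hs.symm.isPiece_left (sup_comm K₁ K₂ ▸ hC) hred hstrict) rfl he

end Pieces

/-! ### The no-retraction theorem by volume comparison -/

section Brouwer

open MeasureTheory Metric Set Polynomial
open scoped RealInnerProductSpace ContDiff NNReal

theorem eval_det_smul_add_one {ι : Type*} [Fintype ι] [DecidableEq ι] (A : Matrix ι ι ℝ) (t : ℝ) :
    ((X : ℝ[X]) • A.map C + (1 : Matrix ι ι ℝ).map C).det.eval t = (1 + t • A).det := by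
  rw [← Polynomial.coe_evalRingHom, RingHom.map_det]
  congr 1
  ext i j
  rw [Matrix.add_apply, RingHom.mapMatrix_apply, Matrix.map_apply, Matrix.add_apply,
    Matrix.smul_apply, Matrix.smul_apply, Matrix.map_apply, Matrix.map_apply, Matrix.one_apply]
  split_ifs <;>
    simp only [coe_evalRingHom, smul_eq_mul, eval_add, eval_mul, eval_X, eval_C] <;> ring

variable {E : Type*} [NormedAddCommGroup E] [InnerProductSpace ℝ E]

theorem exists_norm_eq_one_mem_segment {x y : E} (hx : ‖x‖ ≤ 1) (hy : 1 ≤ ‖y‖) :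
    ∃ z, ‖z‖ = 1 ∧ dist x z ≤ dist x y := by
  have hc : ContinuousOn (fun t : ℝ => ‖AffineMap.lineMap x y t‖) (Icc 0 1) := by
    have : Continuous (fun t : ℝ => (AffineMap.lineMap x y t : E)) := AffineMap.lineMap_continuous
    exact this.norm.continuousOn
  obtain ⟨t, ht, hz⟩ := intermediate_value_Icc zero_le_one hc
    (show (1 : ℝ) ∈ Icc _ _ by simpa using ⟨hx, hy⟩)
  refine ⟨AffineMap.lineMap x y t, hz, ?_⟩
  rw [dist_left_lineMap, Real.norm_of_nonneg ht.1]
  exact mul_le_of_le_one_left dist_nonneg ht.2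

/-- Extending by zero outside the unit ball preserves Lipschitz bounds. -/
theorem lipschitzWith_indicator {h : E → E} {L : ℝ≥0} (hL : LipschitzOnWith L h (closedBall 0 1))
    (h0 : ∀ x, ‖x‖ = 1 → h x = 0) : LipschitzWith L ((closedBall (0 : E) 1).indicator h) := by
  have key : ∀ x y : E, ‖x‖ ≤ 1 → ¬ ‖y‖ ≤ 1 → dist (h x) 0 ≤ L * dist x y := by
    intro x y hx hy
    obtain ⟨z, hz, hxz⟩ := exists_norm_eq_one_mem_segment hx (not_le.1 hy).le
    rw [← h0 z hz]
    exact (hL.dist_le_mul x (by simpa using hx) z (by simp [hz])).trans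
      (mul_le_mul_of_nonneg_left hxz L.2)
  classical
  refine LipschitzWith.of_dist_le_mul fun x y => ?_
  simp only [Set.indicator_apply, mem_closedBall_zero_iff]
  split_ifs with hx hy hy
  · exact hL.dist_le_mul x (by simpa using hx) y (by simpa using hy)
  · exact key x y hx hy
  · rw [dist_comm, dist_comm x y]
    exact key y x hy hx
  · simpa using mul_nonneg L.2 dist_nonneg

variable [FiniteDimensional ℝ E]

theorem exists_det_polynomial (A : E →L[ℝ] E) :
    ∃ p : ℝ[X], p.natDegree ≤ Module.finrank ℝ E ∧
      ∀ t : ℝ, p.eval t = (ContinuousLinearMap.id ℝ E + t • A).det := by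
  set b := Module.finBasis ℝ E
  have hdeg := natDegree_det_X_add_C_le (LinearMap.toMatrix b b (A : E →ₗ[ℝ] E)) 1
  rw [Fintype.card_fin] at hdeg
  refine ⟨_, hdeg, fun t => ?_⟩
  rw [eval_det_smul_add_one, ContinuousLinearMap.det, ← LinearMap.det_toMatrix b]
  congr 1
  simp [map_add, map_smul]

/-- The determinant of `1 + A` is a fixed affine combination of the determinants of `1 + tᵢ A`. -/
theorem exists_det_interpolation {ε : ℝ} (hε : 0 < ε) : ∃ (s : Finset ℝ) (c : ℝ → ℝ),
    (∀ t ∈ s, 0 < t ∧ t ≤ ε) ∧ ∑ t ∈ s, c t = 1 ∧ ∀ A : E →L[ℝ] E,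
      (ContinuousLinearMap.id ℝ E + A).det =
        ∑ t ∈ s, c t * (ContinuousLinearMap.id ℝ E + t • A).det := by
  -- The determinant is a polynomial in `t` of degree at most the dimension, so dimension plus one
  -- nodes determine its value at `1`.
  obtain ⟨s, hs, hcard⟩ := (Set.Ioc_infinite hε).exists_subset_card_eq (Module.finrank ℝ E + 1)
  have key : ∀ A : E →L[ℝ] E, (ContinuousLinearMap.id ℝ E + A).det =
      ∑ t ∈ s, (Lagrange.basis s id t).eval 1 * (ContinuousLinearMap.id ℝ E + t • A).det := by
    intro A
    obtain ⟨p, hp, hpe⟩ := exists_det_polynomial A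
    have hdeg : p.degree < s.card := by
      refine degree_le_natDegree.trans_lt ?_
      rw [hcard]
      exact_mod_cast Nat.lt_succ_of_le hp
    have h := Lagrange.eq_interpolate (v := id) Function.injective_id.injOn hdeg
    have h1 : p.eval 1 = (ContinuousLinearMap.id ℝ E + A).det := by rw [hpe, one_smul]
    rw [← h1]
    conv_lhs => rw [h]
    rw [Lagrange.interpolate_apply, eval_finsetSum]
    refine Finset.sum_congr rfl fun t _ => ?_
    rw [eval_mul, eval_C, id, hpe, mul_comm]
  refine ⟨s, fun t => (Lagrange.basis s id t).eval 1, fun t ht => hs ht, ?_, key⟩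
  rw [← eval_finsetSum, Lagrange.sum_basis Function.injective_id.injOn
    (Finset.card_pos.1 (by omega)), eval_one]

/-- A perturbation of the identity with Lipschitz constant below one is bijective. -/
theorem bijective_id_add_smul {h : E → E} {L : ℝ≥0} (hL : LipschitzWith L h) {t : ℝ} (ht : 0 < t)
    (htL : t * L < 1) : Function.Bijective fun x => x + t • h x := by
  have ha : ApproximatesLinearOn (fun x => x + t • h x)
      ((ContinuousLinearEquiv.refl ℝ E : E ≃L[ℝ] E) : E →L[ℝ] E) univ (t.toNNReal * L) := by
    intro x _ y _
    have : x + t • h x - (y + t • h y) - (x - y) = t • (h x - h y) := by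
      rw [smul_sub]; abel
    simp only [ContinuousLinearEquiv.coe_coe, ContinuousLinearEquiv.coe_refl', id_eq]
    rw [this, norm_smul, Real.norm_of_nonneg ht.le, NNReal.coe_mul, Real.coe_toNNReal _ ht.le,
      mul_assoc, ← dist_eq_norm, ← dist_eq_norm]
    exact mul_le_mul_of_nonneg_left (hL.dist_le_mul x y) ht.le
  have hc : Subsingleton E ∨ t.toNNReal * L <
      ‖(((ContinuousLinearEquiv.refl ℝ E : E ≃L[ℝ] E).symm : E ≃L[ℝ] E) : E →L[ℝ] E)‖₊⁻¹ := by
    rcases subsingleton_or_nontrivial E with hE | hE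
    · exact Or.inl hE
    · right
      have : ‖(((ContinuousLinearEquiv.refl ℝ E : E ≃L[ℝ] E).symm : E ≃L[ℝ] E) : E →L[ℝ] E)‖₊ = 1 :=
        NNReal.eq ContinuousLinearMap.norm_id
      rw [this, inv_one, ← NNReal.coe_lt_coe, NNReal.coe_mul, Real.coe_toNNReal _ ht.le]
      exact htL
  exact ⟨injOn_univ.1 (ha.injOn hc), ha.surjective hc⟩

/-- The image of the derivative is orthogonal to `r x ≠ 0`, so the derivative is not onto. -/
theorem det_fderiv_eq_zero_of_norm_eq_one {r : E → E} (hr : Differentiable ℝ r)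
    (h1 : ∀ x, ‖r x‖ = 1) (x : E) : (fderiv ℝ r x).det = 0 := by
  by_contra hdet
  have hinner : ∀ v, ⟪r x, fderiv ℝ r x v⟫ = 0 := by
    intro v
    have h2 : HasFDerivAt (fun y => ‖r y‖ ^ 2) _ x := (hr x).hasFDerivAt.norm_sq
    have h3 : HasFDerivAt (fun y => ‖r y‖ ^ 2) (0 : E →L[ℝ] ℝ) x := by
      simp only [h1]
      exact hasFDerivAt_const _ _
    have := DFunLike.congr_fun (h2.unique h3) v
    simpa using this
  have hunit : IsUnit (LinearMap.det (fderiv ℝ r x : E →ₗ[ℝ] E)) := isUnit_iff_ne_zero.2 hdet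
  have hsurj := (LinearEquiv.ofIsUnitDet (v := Module.finBasis ℝ E) (v' := Module.finBasis ℝ E)
    (f := (fderiv ℝ r x : E →ₗ[ℝ] E)) (by rwa [LinearMap.det_toMatrix])).surjective
  obtain ⟨v, hv⟩ := hsurj (r x)
  have hv' : fderiv ℝ r x v = r x := hv
  have := hinner v
  rw [hv', real_inner_self_eq_norm_sq, h1] at this
  norm_num at this

variable [MeasurableSpace E] [BorelSpace E]

/-- There is no continuously differentiable retraction of the ball onto the sphere. -/
theorem no_contDiff_retraction {r : E → E} (hr : ContDiff ℝ 1 r) (h1 : ∀ x, ‖r x‖ = 1)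
    (hs : ∀ x, ‖x‖ = 1 → r x = x) : False := by
  classical
  have hrd : Differentiable ℝ r := hr.differentiable one_ne_zero
  set h : E → E := fun x => r x - x with hh
  have hhc : ContDiff ℝ 1 h := hr.sub contDiff_id
  have hhd : Differentiable ℝ h := hhc.differentiable one_ne_zero
  have hfc : Continuous (fderiv ℝ h) := hhc.continuous_fderiv one_ne_zero
  obtain ⟨L', hL'⟩ := (isCompact_closedBall (0 : E) 1).exists_bound_of_continuousOn hfc.continuousOn
  set L : ℝ≥0 := L'.toNNReal with hLdef
  have hLb : ∀ x ∈ closedBall (0 : E) 1, ‖fderiv ℝ h x‖ ≤ L := fun x hx =>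
    (hL' x hx).trans (Real.le_coe_toNNReal L')
  have hLip : LipschitzOnWith L h (closedBall 0 1) :=
    (convex_closedBall (0 : E) 1).lipschitzOnWith_of_nnnorm_fderiv_le (fun x _ => hhd x)
      fun x hx => hLb x hx
  -- Since `h` vanishes on the sphere, extension by zero makes the global bijectivity criterion
  -- available.
  have hLip' := lipschitzWith_indicator hLip fun x hx => by rw [hh]; simp [hs x hx]
  obtain ⟨δ, hδ, hdet⟩ : ∃ δ > 0, ∀ A : E →L[ℝ] E, ‖A‖ < δ →
      0 < (ContinuousLinearMap.id ℝ E + A).det := by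
    have hc : Continuous fun A : E →L[ℝ] E => (ContinuousLinearMap.id ℝ E + A).det :=
      ContinuousLinearMap.continuous_det.comp (continuous_const.add continuous_id)
    have hpos : (0 : ℝ) < (ContinuousLinearMap.id ℝ E + 0).det := by
      simp [ContinuousLinearMap.det]
    obtain ⟨δ, hδ, h⟩ := Metric.eventually_nhds_iff.1 (hc.continuousAt.eventually_const_lt hpos)
    exact ⟨δ, hδ, fun A hA => h (by simpa using hA)⟩
  -- The bounds serve, in order, bijectivity, positivity of the Jacobian, and convexity of `(1 - t)
  -- x + t r x`.
  obtain ⟨ε, hε, hεL, hεδ, hε1⟩ : ∃ ε : ℝ, 0 < ε ∧ ε * L < 1 ∧ ε * L < δ ∧ ε < 1 := by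
    have hL1 : (0 : ℝ) < L + 1 := by positivity
    refine ⟨min 1 δ / 2 / (L + 1), by positivity, ?_, ?_, ?_⟩
    all_goals
      have hm1 : min 1 δ ≤ 1 := min_le_left _ _
      have hm2 : min 1 δ ≤ δ := min_le_right _ _
      have hm0 : 0 < min 1 δ := by positivity
      have hL0 : (0 : ℝ) ≤ L := L.2
      first
        | rw [div_mul_eq_mul_div, div_lt_iff₀ hL1]; nlinarith
        | rw [div_lt_iff₀ hL1]; nlinarith
  obtain ⟨s, c, hsε, hc1, hcdet⟩ := exists_det_interpolation (E := E) hε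
  have hvol : ∀ t ∈ s, ∫ x in ball (0 : E) 1, (ContinuousLinearMap.id ℝ E + t • fderiv ℝ h x).det =
      volume.real (ball (0 : E) 1) := by
    intro t ht
    obtain ⟨ht0, htε⟩ := hsε t ht
    have htL : t * L ≤ ε * L := mul_le_mul_of_nonneg_right htε L.2
    have hbij := bijective_id_add_smul hLip' ht0 (htL.trans_lt hεL)
    have heq : ∀ x ∈ closedBall (0 : E) 1,
        x + t • (closedBall (0 : E) 1).indicator h x = x + t • h x := fun x hx => by
      rw [indicator_of_mem hx]
    have hinj : InjOn (fun x => x + t • h x) (ball (0 : E) 1) := by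
      intro x hx y hy hxy
      refine hbij.1 ?_
      simp only [heq x (ball_subset_closedBall hx), heq y (ball_subset_closedBall hy)]
      exact hxy
    have himg : (fun x => x + t • h x) '' ball (0 : E) 1 = ball 0 1 := by
      refine Subset.antisymm ?_ fun y hy => ?_
      · rintro _ ⟨x, hx, rfl⟩
        rw [mem_ball_zero_iff] at hx ⊢
        have : x + t • h x = (1 - t) • x + t • r x := by
          simp only [hh, smul_sub, sub_smul, one_smul]; abel
        simp only [this]
        calc ‖(1 - t) • x + t • r x‖ ≤ ‖(1 - t) • x‖ + ‖t • r x‖ := norm_add_le _ _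
          _ = (1 - t) * ‖x‖ + t := by
            rw [norm_smul, norm_smul, h1, Real.norm_of_nonneg (by linarith),
              Real.norm_of_nonneg ht0.le, mul_one]
          _ < 1 := by nlinarith
      · obtain ⟨x, hx⟩ := hbij.2 y
        by_cases hx1 : ‖x‖ < 1
        · refine ⟨x, by simpa using hx1, ?_⟩
          simp only at hx ⊢
          rw [← hx, heq x (by simpa using hx1.le)]
        · exfalso
          have : (closedBall (0 : E) 1).indicator h x = 0 := by
            rw [indicator_apply]
            split_ifs with hm
            · rw [hh]
              simp [hs x (le_antisymm (by simpa using hm) (not_lt.1 hx1))]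
            · rfl
          simp only [this, smul_zero, add_zero] at hx
          rw [hx] at hx1
          exact hx1 (by simpa using hy)
    have hderiv : ∀ x ∈ ball (0 : E) 1, HasFDerivWithinAt (fun x => x + t • h x)
        (ContinuousLinearMap.id ℝ E + t • fderiv ℝ h x) (ball 0 1) x := fun x _ =>
      ((hasFDerivAt_id x).add ((hhd x).hasFDerivAt.const_smul t)).hasFDerivWithinAt
    have := integral_image_eq_integral_abs_det_fderiv_smul volume measurableSet_ball hderiv hinj
      (fun _ => (1 : ℝ))
    rw [himg] at this
    simp only [integral_const, smul_eq_mul, mul_one, measureReal_restrict_apply_univ] at this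
    rw [this]
    refine setIntegral_congr_fun measurableSet_ball fun x hx => ?_
    refine (abs_of_pos (hdet _ ?_)).symm
    rw [norm_smul, Real.norm_of_nonneg ht0.le]
    exact ((mul_le_mul_of_nonneg_left (hLb x (ball_subset_closedBall hx)) ht0.le).trans
      htL).trans_lt hεδ
  have hzero : ∀ x, (ContinuousLinearMap.id ℝ E + fderiv ℝ h x).det = 0 := by
    intro x
    have : ContinuousLinearMap.id ℝ E + fderiv ℝ h x = fderiv ℝ r x := by
      have h2 : fderiv ℝ h x = fderiv ℝ r x - ContinuousLinearMap.id ℝ E :=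
        ((hrd x).hasFDerivAt.sub (hasFDerivAt_id x)).fderiv
      rw [h2]; abel
    rw [this]
    exact det_fderiv_eq_zero_of_norm_eq_one hrd h1 x
  -- Interpolation carries the volume identity from small `t` to `t = 1`, where the Jacobian is
  -- zero.
  have hsum : ∫ x in ball (0 : E) 1, (ContinuousLinearMap.id ℝ E + fderiv ℝ h x).det =
      volume.real (ball (0 : E) 1) := by
    rw [show (fun x => (ContinuousLinearMap.id ℝ E + fderiv ℝ h x).det) = fun x => ∑ t ∈ s,
      c t * (ContinuousLinearMap.id ℝ E + t • fderiv ℝ h x).det from funext fun x => hcdet _,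
      integral_finsetSum]
    · simp only [integral_const_mul]
      rw [Finset.sum_congr rfl fun t ht => by rw [hvol t ht], ← Finset.sum_mul, hc1, one_mul]
    · intro t _
      have hcont : Continuous fun x => c t * (ContinuousLinearMap.id ℝ E + t • fderiv ℝ h x).det :=
        continuous_const.mul (ContinuousLinearMap.continuous_det.comp
          (continuous_const.add (hfc.const_smul t)))
      exact (hcont.continuousOn.integrableOn_compact (isCompact_closedBall 0 1)).mono_set
        ball_subset_closedBall
  simp only [hzero, integral_zero] at hsum
  have hpos : 0 < volume.real (ball (0 : E) 1) :=
    ENNReal.toReal_pos (measure_ball_pos volume 0 one_pos).ne' measure_ball_lt_top.ne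
  exact hpos.ne hsum

end Brouwer

/-! ### Invariance of domain -/

section InvarianceOfDomain

open MeasureTheory Metric Set Topology
open scoped RealInnerProductSpace ContDiff

variable {E : Type*} [NormedAddCommGroup E] [InnerProductSpace ℝ E] [FiniteDimensional ℝ E]
  [MeasurableSpace E] [BorelSpace E]

/-- A continuous map without zeros cannot be the identity outside a ball. -/
theorem exists_eq_zero_of_eqOn_id {Φ : E → E} (hΦ : Continuous Φ) {R : ℝ} (hR : 0 < R)
    (h : ∀ x, R ≤ ‖x‖ → Φ x = x) : ∃ x, Φ x = 0 := by
  by_contra! h0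
  have hU : {x : E | R < ‖x‖} ∈ 𝓝ˢ {x : E | R + 1 ≤ ‖x‖} := by
    refine (isOpen_lt continuous_const continuous_norm).mem_nhdsSet.2 fun x hx => ?_
    exact lt_of_lt_of_le (by linarith) (show R + 1 ≤ ‖x‖ from hx)
  have hsm : ContDiffOn ℝ ((1 : ℕ∞) : WithTop ℕ∞) Φ {x : E | R < ‖x‖} :=
    contDiffOn_id.congr fun x hx => h x (le_of_lt hx)
  -- An approximation closer than `‖Φ x‖` has no zeros. Normalised and rescaled by `R + 1`, it
  -- becomes a retraction onto the sphere.
  obtain ⟨g, hg, hgd, hge, -⟩ := hΦ.exists_contDiff_approx_and_eqOn 1 hΦ.norm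
    (fun x => norm_pos_iff.2 (h0 x)) (isClosed_le continuous_const continuous_norm) hU hsm
  have hg0 : ∀ x, g x ≠ 0 := by
    intro x hx
    have := hgd x
    rw [hx, dist_zero_left] at this
    exact this.false
  have hc : ContDiff ℝ 1 fun x : E => g ((R + 1) • x) :=
    ContDiff.comp (g := g) (by exact_mod_cast hg) (contDiff_id.const_smul _)
  have hne : ∀ x : E, ‖g ((R + 1) • x)‖ ≠ 0 := fun x => norm_ne_zero_iff.2 (hg0 _)
  refine no_contDiff_retraction (E := E) (r := fun x => ‖g ((R + 1) • x)‖⁻¹ • g ((R + 1) • x))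
    (((hc.norm ℝ fun x => hg0 _).inv hne).smul hc) (fun x => ?_) fun x hx => ?_
  · rw [norm_smul, norm_inv, norm_norm, inv_mul_cancel₀ (hne x)]
  · have hn : ‖(R + 1) • x‖ = R + 1 := by
      rw [norm_smul, hx, mul_one, Real.norm_of_nonneg (by linarith)]
    have : g ((R + 1) • x) = (R + 1) • x := by
      rw [hge (show R + 1 ≤ ‖(R + 1) • x‖ from hn.ge), h _ (by linarith)]
    simp only [this, hn]
    rw [inv_smul_smul₀ (by linarith)]

/-- A continuous map of the closed unit ball that points outwards on the sphere has a zero. -/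
theorem exists_eq_zero_of_inner_pos {H : E → E} (hH : ContinuousOn H (closedBall 0 1))
    (hpos : ∀ x, ‖x‖ = 1 → 0 < ⟪H x, x⟫) : ∃ x ∈ closedBall (0 : E) 1, H x = 0 := by
  by_contra! h0
  -- Blend `H` after the radial retraction `p` into the identity between radii 1 and 2. Outside the
  -- unit ball the blend has positive inner product with `x`, so its zero lies inside.
  set p : E → E := fun x => (max 1 ‖x‖)⁻¹ • x with hp
  set c : E → ℝ := fun x => min 1 (max 0 (‖x‖ - 1)) with hc
  have hm : ∀ x : E, 0 < max 1 ‖x‖ := fun x => lt_max_of_lt_left one_pos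
  have hpc : Continuous p :=
    ((continuous_const.max continuous_norm).inv₀ fun x => (hm x).ne').smul continuous_id
  have hpb : ∀ x, p x ∈ closedBall (0 : E) 1 := by
    intro x
    rw [mem_closedBall_zero_iff, hp, norm_smul, norm_inv, Real.norm_of_nonneg (hm x).le,
      inv_mul_le_iff₀ (hm x), mul_one]
    exact le_max_right _ _
  have hcc : Continuous c :=
    continuous_const.min (continuous_const.max (continuous_norm.sub continuous_const))
  have hHp : Continuous fun x => H (p x) := hH.comp_continuous hpc hpb
  obtain ⟨x, hx⟩ := exists_eq_zero_of_eqOn_id (Φ := fun x => (1 - c x) • H (p x) + c x • x)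
    (((continuous_const.sub hcc).smul hHp).add (hcc.smul continuous_id)) (R := 2) two_pos
    (fun x hx => by
      have : c x = 1 := by
        rw [hc]; simp only; rw [max_eq_right (by linarith), min_eq_left (by linarith)]
      simp [this])
  rcases le_or_gt ‖x‖ 1 with hx1 | hx1
  · have h1 : c x = 0 := by
      rw [hc]; simp only; rw [max_eq_left (by linarith), min_eq_right zero_le_one]
    have h2 : p x = x := by rw [hp]; simp only; rw [max_eq_left hx1, inv_one, one_smul]
    simp only [h1, h2, sub_zero, one_smul, zero_smul, add_zero] at hx
    exact h0 x (by simpa using hx1) hx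
  · have hx0 : 0 < ‖x‖ := by linarith
    have hpx : p x = ‖x‖⁻¹ • x := by rw [hp]; simp only; rw [max_eq_right hx1.le]
    have hpn : ‖p x‖ = 1 := by
      rw [hpx, norm_smul, norm_inv, norm_norm, inv_mul_cancel₀ hx0.ne']
    have hxp : x = ‖x‖ • p x := by rw [hpx, smul_inv_smul₀ hx0.ne']
    have hin : 0 < ⟪H (p x), x⟫ := by
      have h3 : ⟪H (p x), x⟫ = ‖x‖ * ⟪H (p x), p x⟫ := by
        conv_lhs => rw [hxp]
        rw [inner_smul_right]
        simp only [← hxp]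
      rw [h3]
      exact mul_pos hx0 (hpos _ hpn)
    have hc0 : 0 < c x := lt_min one_pos (lt_max_of_lt_right (by linarith))
    have hc1 : c x ≤ 1 := min_le_left _ _
    have h4 : ⟪(1 - c x) • H (p x) + c x • x, x⟫ = 0 := by
      rw [hx, inner_zero_left]
    rw [inner_add_left, real_inner_smul_left, real_inner_smul_left,
      real_inner_self_eq_norm_sq] at h4
    have : 0 ≤ (1 - c x) * ⟪H (p x), x⟫ := mul_nonneg (by linarith) hin.le
    have : 0 < c x * ‖x‖ ^ 2 := by positivity
    linarith

/-- Invariance of domain. -/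
theorem mem_interior_image_closedBall {f : E → E} (hf : ContinuousOn f (closedBall 0 1))
    (hinj : InjOn f (closedBall 0 1)) : f 0 ∈ interior (f '' closedBall 0 1) := by
  by_contra hint
  set K := f '' closedBall (0 : E) 1 with hK
  have hKc : IsCompact K := (isCompact_closedBall 0 1).image_of_continuousOn hf
  -- Tietze extends the inverse of `f`. The plan is to perturb `G` near `f 0` so that it has no zero
  -- on the image while staying close to the inverse.
  obtain ⟨G, hG⟩ : ∃ G : C(E, E), ∀ x ∈ closedBall (0 : E) 1, G (f x) = x := by
    have he : IsClosedEmbedding (fun x : closedBall (0 : E) 1 => f x) :=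
      Continuous.isClosedEmbedding hf.domRestrict
        (fun x y hxy => Subtype.ext (hinj x.2 y.2 hxy))
    have : TietzeExtension E := TietzeExtension.of_tvs ℝ
    obtain ⟨G, hG⟩ := ContinuousMap.exists_extension' he
      (⟨Subtype.val, continuous_subtype_val⟩ : C(closedBall (0 : E) 1, E))
    exact ⟨G, fun x hx => congr_fun hG ⟨x, hx⟩⟩
  have h0 : G (f 0) = 0 := hG 0 (by simp)
  obtain ⟨η, hη, hGη⟩ : ∃ η > 0, ∀ y, dist y (f 0) < η → ‖G y‖ < 1 / 10 := by
    have := G.continuous.norm.continuousAt.eventually_lt_const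
      (show ‖G (f 0)‖ < 1 / 10 by rw [h0]; norm_num)
    exact Metric.eventually_nhds_iff.1 this
  set ε := η / 2 with hε
  have hε0 : 0 < ε := by positivity
  obtain ⟨c, hcK, hcd⟩ : ∃ c, c ∉ K ∧ dist c (f 0) < ε := by
    rw [mem_interior_iff_mem_nhds, Metric.mem_nhds_iff] at hint
    push Not at hint
    obtain ⟨c, hc, hcK⟩ := Set.not_subset.1 (hint ε hε0)
    exact ⟨c, hcK, hc⟩
  obtain ⟨δ, hδ, hδG⟩ : ∃ δ > 0, ∀ y ∈ K, ε ≤ dist y c → δ ≤ ‖G y‖ := by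
    have hcomp : IsCompact (K ∩ {y | ε ≤ dist y c}) :=
      hKc.inter_right (isClosed_le continuous_const (continuous_id.dist continuous_const))
    obtain ⟨δ, hδ, h⟩ := hcomp.exists_forall_le' G.continuous.norm.continuousOn (a := 0) (by
      rintro _ ⟨⟨x, hx, rfl⟩, hxc⟩
      rw [hG x hx, norm_pos_iff]
      rintro rfl
      rw [mem_ofPred_eq, dist_comm] at hxc
      exact absurd hxc (not_le.2 hcd))
    exact ⟨δ, hδ, fun y hy hyc => h y ⟨hy, hyc⟩⟩
  set κ := min δ (1 / 10) / 2 with hκ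
  have hκ0 : 0 < κ := by positivity
  have hκδ : κ + κ ≤ δ := by rw [hκ, add_halves]; exact min_le_left _ _
  have hκ1 : κ + κ ≤ 1 / 10 := by rw [hκ, add_halves]; exact min_le_right _ _
  obtain ⟨P, hP, hPG, -⟩ := G.continuous.exists_contDiff_approx 1
    (continuous_const (y := κ)) (fun _ => hκ0)
  -- A differentiable map sends the sphere to a null set, so a small translation of `P` has no zero
  -- there.
  obtain ⟨a, haκ, haP⟩ : ∃ a : E, ‖a‖ < κ ∧ a ∉ P '' sphere c ε := by
    have hnull : volume (P '' sphere c ε) = 0 :=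
      addHaar_image_eq_zero_of_differentiableOn_of_addHaar_eq_zero _
        ((hP.differentiable (by simp)).differentiableOn)
        (Measure.addHaar_sphere_of_ne_zero _ _ hε0.ne')
    by_contra! h
    have hsub : ball (0 : E) κ ⊆ P '' sphere c ε := fun a ha => h a (by simpa using ha)
    exact (measure_ball_pos volume (0 : E) hκ0).ne' (measure_mono_null hsub hnull)
  have hPa : ∀ y, ‖(P y - a) - G y‖ < κ + κ := by
    intro y
    calc ‖(P y - a) - G y‖ = ‖(P y - G y) - a‖ := by congr 1; abel
      _ ≤ ‖P y - G y‖ + ‖a‖ := norm_sub_le _ _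
      _ < κ + κ := add_lt_add (by rw [← dist_eq_norm]; exact hPG y) haκ
  -- `q` pushes the ball around `c` radially onto its sphere; it is continuous on `K` because `c ∉
  -- K`.
  set q : E → E := fun y => c + max (ε / ‖y - c‖) 1 • (y - c) with hq
  have hqfar : ∀ y, ε ≤ ‖y - c‖ → q y = y := by
    intro y hy
    have : ε / ‖y - c‖ ≤ 1 := div_le_one_of_le₀ hy (norm_nonneg _)
    simp only [hq, max_eq_right this, one_smul, add_sub_cancel]
  have hqnear : ∀ y, y ≠ c → ‖y - c‖ ≤ ε → ‖q y - c‖ = ε := by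
    intro y hyc hy
    have hpos : 0 < ‖y - c‖ := norm_pos_iff.2 (sub_ne_zero.2 hyc)
    have : 1 ≤ ε / ‖y - c‖ := (one_le_div hpos).2 hy
    simp only [hq, max_eq_left this, add_sub_cancel_left, norm_smul, norm_div, norm_norm,
      Real.norm_of_nonneg hε0.le]
    exact div_mul_cancel₀ _ hpos.ne'
  have hqcont : ContinuousOn q K := by
    refine continuousOn_const.add (ContinuousOn.smul (ContinuousOn.sup ?_ continuousOn_const)
      (continuousOn_id.sub continuousOn_const))
    refine ContinuousOn.div continuousOn_const
      (continuous_id.sub continuous_const).norm.continuousOn fun y hy h => ?_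
    rw [norm_eq_zero, sub_eq_zero] at h
    exact hcK (h ▸ hy)
  have hHcont : ContinuousOn (fun x => P (q (f x)) - a) (closedBall 0 1) :=
    ((hP.continuous.comp_continuousOn hqcont).comp hf (mapsTo_image f _)).sub continuousOn_const
  have hclose : ∀ x ∈ closedBall (0 : E) 1, ‖(P (q (f x)) - a) - x‖ < 1 := by
    intro x hx
    rcases le_total ε ‖f x - c‖ with h | h
    · have := hPa (f x)
      rw [hG x hx] at this
      rw [hqfar _ h]
      linarith
    · have hne : f x ≠ c := fun h' => hcK (h' ▸ mem_image_of_mem f hx)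
      have h1 := hqnear _ hne h
      have h2 : ‖G (q (f x))‖ < 1 / 10 := by
        refine hGη _ ((dist_triangle _ c _).trans_lt ?_)
        rw [dist_eq_norm, h1]
        linarith
      have h3 : ‖G (f x)‖ < 1 / 10 := by
        refine hGη _ ((dist_triangle _ c _).trans_lt ?_)
        rw [dist_eq_norm]
        linarith
      rw [hG x hx] at h3
      calc ‖(P (q (f x)) - a) - x‖ = ‖((P (q (f x)) - a) - G (q (f x))) + G (q (f x)) - x‖ := by
            congr 1; abel
        _ ≤ ‖((P (q (f x)) - a) - G (q (f x))) + G (q (f x))‖ + ‖x‖ := norm_sub_le _ _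
        _ ≤ ‖(P (q (f x)) - a) - G (q (f x))‖ + ‖G (q (f x))‖ + ‖x‖ := by
            gcongr; exact norm_add_le _ _
        _ < 1 := by have := hPa (q (f x)); linarith
  obtain ⟨x, hx, hx0⟩ := exists_eq_zero_of_inner_pos hHcont fun x hx => by
    have h1 := hclose x (by simp [hx])
    have h2 : P (q (f x)) - a = ((P (q (f x)) - a) - x) + x := by abel
    rw [h2, inner_add_left, real_inner_self_eq_norm_sq, hx]
    have h3 := abs_le.1 (abs_real_inner_le_norm ((P (q (f x)) - a) - x) x)
    rw [hx, mul_one] at h3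
    linarith [h3.1]
  rcases le_total ε ‖f x - c‖ with h | h
  · rw [hqfar _ h] at hx0
    have h1 := hPa (f x)
    rw [hx0, zero_sub, norm_neg] at h1
    have h2 := hδG (f x) (mem_image_of_mem f hx) (by rwa [dist_eq_norm])
    linarith
  · have hne : f x ≠ c := fun h' => hcK (h' ▸ mem_image_of_mem f hx)
    refine haP ⟨q (f x), ?_, sub_eq_zero.1 hx0⟩
    rw [mem_sphere, dist_eq_norm]
    exact hqnear _ hne h

end InvarianceOfDomain

/-! ### Triangles of a 3-ball lie in at most two tetrahedra -/

section Realization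

open Metric Set Topology

variable {V : Type*} [DecidableEq V]

/-- A chart of the union of the simplices `abcd` and `abcd'` around the barycentre of `abc`. -/
noncomputable def bookChart (a b c d d' : V) (x : EuclideanSpace ℝ (Fin 3)) : V → ℝ := fun v =>
  if v = a then 1 / 3 + x 0 / 12 else if v = b then 1 / 3 + x 1 / 12 else
  if v = c then 1 / 3 - x 0 / 12 - x 1 / 12 - |x 2| / 12 else
  if v = d then max (x 2 / 12) 0 else if v = d' then max (-x 2 / 12) 0 else 0

theorem continuous_bookChart (a b c d d' : V) : Continuous (bookChart a b c d d') := by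
  refine continuous_pi fun v => ?_
  unfold bookChart
  split_ifs <;> fun_prop

theorem abs_apply_le_one {x : EuclideanSpace ℝ (Fin 3)} (hx : x ∈ closedBall 0 1) (i : Fin 3) :
    |x i| ≤ 1 := by
  have := PiLp.norm_apply_le x i
  rw [Real.norm_eq_abs] at this
  exact this.trans (by simpa using hx)

variable {a b c d d' : V}

theorem bookChart_nonneg {x : EuclideanSpace ℝ (Fin 3)} (hx : x ∈ closedBall 0 1) (v : V) :
    0 ≤ bookChart a b c d d' x v := by
  -- The factor `1 / 12` works because `1 / 3` exceeds `3 / 12`.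
  have h0 := abs_le.1 (abs_apply_le_one hx 0)
  have h1 := abs_le.1 (abs_apply_le_one hx 1)
  have h2 := abs_apply_le_one hx 2
  unfold bookChart
  split_ifs
  · linarith
  · linarith
  · linarith
  · exact le_max_right _ _
  · exact le_max_right _ _
  · exact le_rfl

theorem sum_bookChart (hab : a ≠ b) (hac : a ≠ c) (hbc : b ≠ c) {e : V}
    (he : e ∉ ({a, b, c} : Finset V)) (x : EuclideanSpace ℝ (Fin 3)) :
    ∑ v ∈ insert e ({a, b, c} : Finset V), bookChart a b c d d' x v =
      1 - |x 2| / 12 + bookChart a b c d d' x e := by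
  rw [Finset.sum_insert he, Finset.sum_insert (by simp [hab, hac]), Finset.sum_pair hbc]
  simp only [bookChart, if_true, hab.symm, hac.symm, hbc.symm, if_false]
  ring

theorem bookChart_mem_realization {B : PreAbstractSimplicialComplex V} (hab : a ≠ b) (hac : a ≠ c)
    (hbc : b ≠ c) (hd : d ∉ ({a, b, c} : Finset V)) (hd' : d' ∉ ({a, b, c} : Finset V))
    (hdd' : d ≠ d') (hB : insert d ({a, b, c} : Finset V) ∈ B)
    (hB' : insert d' ({a, b, c} : Finset V) ∈ B) {x : EuclideanSpace ℝ (Fin 3)}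
    (hx : x ∈ closedBall 0 1) : bookChart a b c d d' x ∈ realization B := by
  have hda := hd
  have hda' := hd'
  simp only [Finset.mem_insert, Finset.mem_singleton, not_or] at hda hda'
  rcases le_total 0 (x 2) with h | h
  · refine ⟨_, hB, bookChart_nonneg hx, fun v hv => ?_, ?_⟩
    · simp only [Finset.mem_insert, Finset.mem_singleton, not_or] at hv
      simp only [bookChart, hv, if_false]
      split_ifs
      · exact max_eq_right (by linarith)
      · rfl
    · rw [sum_bookChart hab hac hbc hd]
      simp only [bookChart, hda, if_false, if_true]
      rw [abs_of_nonneg h, max_eq_left (by linarith)]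
      ring
  · refine ⟨_, hB', bookChart_nonneg hx, fun v hv => ?_, ?_⟩
    · simp only [Finset.mem_insert, Finset.mem_singleton, not_or] at hv
      simp only [bookChart, hv, if_false]
      split_ifs
      · exact max_eq_right (by linarith)
      · rfl
    · rw [sum_bookChart hab hac hbc hd']
      simp only [bookChart, hda', hdd'.symm, if_false, if_true]
      rw [abs_of_nonpos h, max_eq_left (by linarith)]
      ring

theorem bookChart_injective (hab : a ≠ b) (hd : d ∉ ({a, b, c} : Finset V))
    (hd' : d' ∉ ({a, b, c} : Finset V)) (hdd' : d ≠ d') :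
    Function.Injective (bookChart a b c d d') := by
  intro x y hxy
  simp only [Finset.mem_insert, Finset.mem_singleton, not_or] at hd hd'
  have ha := congr_fun hxy a
  have hb := congr_fun hxy b
  have hd1 := congr_fun hxy d
  have hd2 := congr_fun hxy d'
  simp only [bookChart, if_true, hab.symm, if_false] at ha hb
  simp only [bookChart, hd, if_false, if_true] at hd1
  simp only [bookChart, hd', hdd'.symm, if_false, if_true] at hd2
  ext i
  fin_cases i
  · change x 0 = y 0
    linarith
  · change x 1 = y 1
    linarith
  · change x 2 = y 2
    rcases le_total 0 (x 2) with h | h <;> rcases le_total 0 (y 2) with h' | h'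
    · rw [max_eq_left (by linarith), max_eq_left (by linarith)] at hd1
      linarith
    · rw [max_eq_right (by linarith), max_eq_left (by linarith)] at hd2
      rw [max_eq_left (by linarith), max_eq_right (by linarith)] at hd1
      linarith
    · rw [max_eq_left (by linarith), max_eq_right (by linarith)] at hd2
      rw [max_eq_right (by linarith), max_eq_left (by linarith)] at hd1
      linarith
    · rw [max_eq_left (by linarith), max_eq_left (by linarith)] at hd2
      linarith

/-- Three tetrahedra with a common triangle do not embed in three-space. -/
theorem not_three_tetrahedra {B : PreAbstractSimplicialComplex V}
    {ψ : (V → ℝ) → EuclideanSpace ℝ (Fin 3)} (hψ : ContinuousOn ψ (realization B))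
    (hinj : InjOn ψ (realization B)) (hab : a ≠ b) (hac : a ≠ c) (hbc : b ≠ c) {d₁ d₂ d₃ : V}
    (h₁ : d₁ ∉ ({a, b, c} : Finset V)) (h₂ : d₂ ∉ ({a, b, c} : Finset V))
    (h₃ : d₃ ∉ ({a, b, c} : Finset V)) (h₁₂ : d₁ ≠ d₂) (h₁₃ : d₁ ≠ d₃) (h₂₃ : d₂ ≠ d₃)
    (hB₁ : insert d₁ ({a, b, c} : Finset V) ∈ B) (hB₂ : insert d₂ ({a, b, c} : Finset V) ∈ B)
    (hB₃ : insert d₃ ({a, b, c} : Finset V) ∈ B) : False := by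
  have hmem : ∀ x ∈ closedBall (0 : EuclideanSpace ℝ (Fin 3)) 1,
      bookChart a b c d₁ d₂ x ∈ realization B := fun x hx =>
    bookChart_mem_realization hab hac hbc h₁ h₂ h₁₂ hB₁ hB₂ hx
  have hmem' : ∀ x ∈ closedBall (0 : EuclideanSpace ℝ (Fin 3)) 1,
      bookChart a b c d₃ d₁ x ∈ realization B := fun x hx =>
    bookChart_mem_realization hab hac hbc h₃ h₁ h₁₃.symm hB₃ hB₁ hx
  -- The image of two tetrahedra is a neighbourhood of the image of the barycentre. A path from
  -- there into the third tetrahedron stays in it for a while, contradicting injectivity through the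
  -- `d₃` coordinate.
  have hint := mem_interior_image_closedBall
    (hψ.comp (continuous_bookChart a b c d₁ d₂).continuousOn hmem)
    (hinj.comp (bookChart_injective hab h₁ h₂ h₁₂).injOn hmem)
  have hzero : bookChart a b c d₁ d₂ 0 = bookChart a b c d₃ d₁ 0 := by
    ext v
    simp [bookChart]
  have hline : ∀ s ∈ Icc (0 : ℝ) 1, EuclideanSpace.single (2 : Fin 3) s ∈
      closedBall (0 : EuclideanSpace ℝ (Fin 3)) 1 := by
    intro s hs
    rw [mem_closedBall_zero_iff, PiLp.norm_single, Real.norm_of_nonneg hs.1]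
    exact hs.2
  have hsingle : Continuous fun s : ℝ => EuclideanSpace.single (2 : Fin 3) s := by
    refine (PiLp.continuous_toLp 2 _).comp (continuous_pi fun i => ?_)
    by_cases hi : i = 2
    · subst hi
      simpa using continuous_id'
    · simpa [hi] using continuous_const
  have hcont : ContinuousOn
      (fun s : ℝ => ψ (bookChart a b c d₃ d₁ (EuclideanSpace.single 2 s))) (Icc 0 1) :=
    hψ.comp ((continuous_bookChart a b c d₃ d₁).comp hsingle).continuousOn
      fun s hs => hmem' _ (hline s hs)
  have h0 : ψ (bookChart a b c d₃ d₁ (EuclideanSpace.single 2 (0 : ℝ))) ∈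
      interior ((ψ ∘ bookChart a b c d₁ d₂) '' closedBall 0 1) := by
    have hz : EuclideanSpace.single (2 : Fin 3) (0 : ℝ) = 0 := by
      ext i; simp
    rw [hz, ← hzero]
    exact hint
  have hev := (hcont 0 (by simp)).preimage_mem_nhdsWithin (isOpen_interior.mem_nhds h0)
  have hev' : ∀ᶠ s in 𝓝[>] (0 : ℝ), ψ (bookChart a b c d₃ d₁ (EuclideanSpace.single 2 s)) ∈
      interior ((ψ ∘ bookChart a b c d₁ d₂) '' closedBall 0 1) := by
    rw [← nhdsWithin_Ioc_eq_nhdsGT (zero_lt_one (α := ℝ))]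
    exact nhdsWithin_mono _ Ioc_subset_Icc_self hev
  obtain ⟨s, hs, hs01⟩ := (hev'.and (Ioc_mem_nhdsGT (zero_lt_one (α := ℝ)))).exists
  obtain ⟨x, hx, hxs⟩ := interior_subset hs
  have heq := hinj (hmem x hx) (hmem' _ (hline s ⟨hs01.1.le, hs01.2⟩)) hxs
  have := congr_fun heq d₃
  simp only [Finset.mem_insert, Finset.mem_singleton, not_or] at h₃
  simp only [bookChart, h₃, h₁₃.symm, h₂₃.symm, if_false, if_true] at this
  have hpos := hs01.1
  have hval : (EuclideanSpace.single (2 : Fin 3) s : EuclideanSpace ℝ (Fin 3)) 2 = s := by simp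
  rw [hval, max_eq_left (by linarith)] at this
  linarith

/-- Every triangle of a simplicial `3`-ball is contained in at most two tetrahedra. -/
theorem IsSimplicialBall.isPseudomanifold {B : PreAbstractSimplicialComplex V}
    (h : IsSimplicialBall 3 B) : IsPseudomanifold 4 B := by
  classical
  obtain ⟨-, ⟨φ⟩⟩ := h
  intro u s₁ s₂ s₃ hu h₁ h₂ h₃ hu₁ hu₂ hu₃
  by_contra! hne
  set ψ : (V → ℝ) → EuclideanSpace ℝ (Fin 3) := fun p =>
    if hp : p ∈ realization B then (φ ⟨p, hp⟩ : EuclideanSpace ℝ (Fin 3)) else 0 with hψdef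
  have hψ : ContinuousOn ψ (realization B) := by
    rw [continuousOn_iff_continuous_domRestrict]
    have : (realization B).domRestrict ψ = fun p => (φ p : EuclideanSpace ℝ (Fin 3)) := by
      ext1 p
      simp [hψdef]
    rw [this]
    exact continuous_subtype_val.comp φ.continuous
  have hinj : InjOn ψ (realization B) := by
    intro p hp q hq hpq
    simp only [hψdef, hp, hq, dif_pos] at hpq
    exact congrArg Subtype.val (φ.injective (Subtype.ext hpq))
  have key : ∀ s : Finset V, Face B s ∧ s.card = 4 → u ⊆ s → ∃ d, d ∉ u ∧ s = insert d u := by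
    intro s hs hus
    obtain ⟨d, hd⟩ := Finset.card_eq_one.1 (show (s \ u).card = 1 by
      rw [Finset.card_sdiff_of_subset hus]; omega)
    have hds : d ∈ s \ u := hd ▸ Finset.mem_singleton_self d
    refine ⟨d, (Finset.mem_sdiff.1 hds).2, ?_⟩
    rw [← Finset.sdiff_union_of_subset hus, hd, Finset.singleton_union]
  obtain ⟨d₁, hd₁, rfl⟩ := key s₁ h₁ hu₁
  obtain ⟨d₂, hd₂, rfl⟩ := key s₂ h₂ hu₂
  obtain ⟨d₃, hd₃, rfl⟩ := key s₃ h₃ hu₃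
  obtain ⟨a, b, c, hab, hac, hbc, rfl⟩ := Finset.card_eq_three.1 (show u.card = 3 by omega)
  exact not_three_tetrahedra hψ hinj hab hac hbc hd₁ hd₂ hd₃ (fun h => hne.1 (by rw [h]))
    (fun h => hne.2.1 (by rw [h])) (fun h => hne.2.2 (by rw [h])) (h₁.1.mem_of_card h₁.2)
    (h₂.1.mem_of_card h₂.2) (h₃.1.mem_of_card h₃.2)

end Realization

end SimplicialBall

open SimplicialBall in
theorem theorem2p3 {V : Type*} (B : PreAbstractSimplicialComplex V)
    (hball : IsSimplicialBall 3 B) (hred : IsReduced B)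
    (hspan : ∃ e : Finset V, IsSpanningEdge B e)
    (hstrict : ∀ e : Finset V, IsSpanningEdge B e → IsStrict B e) :
    ¬ IsConstructible 3 B := by
  classical
  intro hcons
  obtain ⟨e, he⟩ := hspan
  exact (isPiece_self B).not_mem_of_spanning hball.isPseudomanifold hred hstrict hcons he he.1
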